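/- Let $\Omega\subset\mathbb R^d$ ($d\ge 1$) be a bounded open set, let $(\cdot,\cdot)$ and $\|\cdot\|$ be the inner product and norm of $L^2(\Omega)$, let $\varepsilon,L,T>0$, $S\ge 0$, let $f:\mathbb R\to\mathbb R$ be differentiable with $|f'(y)-S|\le L$ for all $y$ (for $S=0$: $|f'|\le L$), let $N\ge 1$, $M\ge 0$, $K\ge1$ be integers, $\tau=T/K$, $t_n=n\tau$, $I_n=[t_{n-1},t_n]$ and $\|w\|_n^2=\int_{I_n}\|w(t)\|^2dt$. Let $P_M^0$ be the space of polynomials of degree $\le M$ on $\Omega$ that vanish on $\partial\Omega$, regarded as a subspace of $H^1_0(\Omega)$, and $V_{M,N}=P_M^0\otimes P_N$ the polynomials of degree $\le N$ in time with coefficients in $P_M^0$. Let $u\in C^{N+1}([0,T];H_0^1(\Omega))$ be a weak solution of the Allen--Cahn equation $u_t-\varepsilon\Delta u+\frac1\varepsilon f(u)=0$, i.e. for $1\le n\le K$, $$\int_{I_n}(u_t,v_t)+\varepsilon(\nabla u,\nabla v_t)+\tfrac1\varepsilon(f(u),v_t)\,dt=0\quad\text{for all } v\in H^1(I_n;H^1_0(\Omega))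 \text{ with } v(t_{n-1})=u(t_{n-1}).$$ Let $h^1\in V_{M,N}$ be arbitrary, and for $2\le n\le K$ let $h^n\in V_{M,N}$ be a solution of the semi-implicit linear scheme on $I_n$: $h^n(t_{n-1})=h^{n-1}(t_{n-1})$ and $$\int_{I_n}(h^n_t,v_t)+\varepsilon(\nabla h^n,\nabla v_t)+\tfrac S\varepsilon(h^n,v_t)+\tfrac1\varepsilon(f(\hat h^n)-S\hat h^n,v_t)\,dt=0\quad\text{for all } v\in V_{M,N}\text{ with }v(t_{n-1})=h^{n-1}(t_{n-1}),$$ where $\hat h^n$ is the extension to $I_n$ of the polynomial $h^{n-1}$. Let $\Pi_M^0:H_0^1(\Omega)\to P_M^0$ be the orthogonal projection with respect to $(\nabla\cdot,\nabla\cdot)$. Let $\Pi_N^n u=\mathcal I_1^nu+\Pi_N^{0,n}(u-\mathcal I^n_1u)$, where $\mathcal I_1^n$ is linear interpolation in time at $t_{n-1},t_n$ and $\Pi_N^{0,n}$ is the projection, orthogonal for $\int_{I_n}v'w'\,dt$, on the polynomials in $t$ of degree $\le N$ that vanish at $t_{n-1}$ and $t_n$. Let $\mathcal T_N^n$ denote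 the Taylor polynomial in time of degree $N$ at $t_{n-1}$. Put $$\Pi^n=\Pi^n_N\Pi^0_M,\quad \hat\Pi^n=\mathcal T^n_N\Pi^0_M,\quad \rho^n=h^n-\Pi^nu,\quad \pi^n=\Pi^nu-u,\quad \hat\pi^n=\hat\Pi^nu-u,$$ $$\pi_M^n=(\Pi_M^0-I)\Pi_N^nu,\qquad \pi_N^n=(\Pi_N^n-I)\Pi_M^0u .$$ Let $L_k$ be the Legendre polynomials, $c_k=\int_1^3L_k^2\,dx\big/\int_{-1}^1L_k^2\,dx$, $C_{N-1}=\big(\sum_{k=0}^{N-1}c_k\big)^{1/2}$, and $$D_\tau=\tfrac{\varepsilon}{L}\Big(\tfrac14-\tfrac{4\tau^2L^2(1+6C_{N-1}^2)}{\varepsilon^2}\Big),\quad D_2=\tfrac{8L}{\varepsilon},\quad D_3=\tfrac{24L\tau C_{N-1}^2}{\varepsilon},$$ $$\hat E_p^k=\tfrac{\varepsilon}{L}\Big[6\|\partial_t\pi_M^k+\tfrac S\varepsilon\pi^k\|_k^2+6\varepsilon^2\|\nabla^2\pi_N^k\|_k^2+\tfrac{4L^2\tau}{\varepsilon^2}\|\pi^k(t_{k-1})\|^2+\tfrac{12L^2\tau^2C_{N-1}^2}{\varepsilon^2}\big(\|\hat\pi^k_t\|_k^2+2\|\partial_t(\hat\Pi^ku-\Pi^{k-1}u)\|_{k-1}^2\big)\Big],$$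 where $\nabla^2$ is the Laplacian. If $\tau\le\dfrac{\varepsilon}{4L\sqrt{6C_{N-1}^2+1}}$, then for all $2\le n\le K$ $$\Big(1+\tfrac{S}{2L}\Big)\|\rho^n(t_n)\|^2+\tfrac{\varepsilon^2}{2L}\|\nabla\rho^n(t_n)\|^2+\sum_{k=1}^nD_\tau\|\rho^k_t\|_k^2+D_3\tau\|\rho^n_t\|_n^2$$ $$\le\sum_{k=2}^ne^{D_2(n-k)\tau}\hat E_p^k+e^{D_2(n-1)\tau}\Big(\big(1+\tfrac{S}{2L}\big)\|\rho^1(t_1)\|^2+\tfrac{\varepsilon^2}{2L}\|\nabla\rho^1(t_1)\|^2+D_3\tau\|\rho_t^1\|_1^2\Big)+D_\tau\|\rho^1_t\|_1^2 .$$ -/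

import Mathlib

open MeasureTheory Set Polynomial
open scoped ContDiff

noncomputable section

namespace ESET

/-! ### The spaces `L²(Ω)` and `H¹₀(Ω)` -/

/-- `L²(Ω)`. -/
abbrev L2 {d : ℕ} (Ω : Set (EuclideanSpace ℝ (Fin d))) : Type :=
  Lp ℝ 2 (volume.restrict Ω)

/-- `L²(Ω; ℝ^d)`. -/
abbrev L2Vec {d : ℕ} (Ω : Set (EuclideanSpace ℝ (Fin d))) : Type :=
  Lp (EuclideanSpace ℝ (Fin d)) 2 (volume.restrict Ω)

/-- The Hilbert space `L²(Ω) × L²(Ω; ℝ^d)`, in which a function is recorded with its gradient. -/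
abbrev L2Pair {d : ℕ} (Ω : Set (EuclideanSpace ℝ (Fin d))) : Type :=
  WithLp 2 (L2 Ω × L2Vec Ω)

/-- The pairs `(φ, ∇φ)` with `φ` smooth and compactly supported in `Ω`. -/
def testPairs {d : ℕ} (Ω : Set (EuclideanSpace ℝ (Fin d))) : Set (L2Pair Ω) :=
  {z | ∃ φ : EuclideanSpace ℝ (Fin d) → ℝ,
    ContDiff ℝ ∞ φ ∧ HasCompactSupport φ ∧ tsupport φ ⊆ Ω ∧
    (z.fst : EuclideanSpace ℝ (Fin d) → ℝ) =ᵐ[volume.restrict Ω] φ ∧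
    (z.snd : EuclideanSpace ℝ (Fin d) → EuclideanSpace ℝ (Fin d))
      =ᵐ[volume.restrict Ω] gradient φ}

/-- `H¹₀(Ω)`: the closure of the test functions in the norm
`(‖w‖² + ‖∇w‖²)^{1/2}`; an element is the pair of a function and its weak gradient. -/
def h01Submodule {d : ℕ} (Ω : Set (EuclideanSpace ℝ (Fin d))) : Submodule ℝ (L2Pair Ω) :=
  (Submodule.span ℝ (testPairs Ω)).topologicalClosure

/-- `H¹₀(Ω)` as a Hilbert space, with its `H¹` norm. -/
abbrev H01 {d : ℕ} (Ω : Set (EuclideanSpace ℝ (Fin d))) : Type := h01Submodule Ω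

/-- The element `w ∈ H¹₀(Ω)` as an element of `L²(Ω)`. -/
def toL2 {d : ℕ} {Ω : Set (EuclideanSpace ℝ (Fin d))} (w : H01 Ω) : L2 Ω :=
  (w : L2Pair Ω).fst

/-- The weak gradient of `w ∈ H¹₀(Ω)`. -/
def grad {d : ℕ} {Ω : Set (EuclideanSpace ℝ (Fin d))} (w : H01 Ω) : L2Vec Ω :=
  (w : L2Pair Ω).snd

/-- The pairing `(g(w), v) = ∫_Ω g(w(x)) v(x) dx`. -/
def nonlinPair {d : ℕ} {Ω : Set (EuclideanSpace ℝ (Fin d))} (g : ℝ → ℝ) (w v : H01 Ω) : ℝ :=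
  ∫ x in Ω, g (toL2 w x) * toL2 v x

/-- `g ∈ L²(Ω)` is the (weak) Laplacian of `w ∈ H¹₀(Ω)`. -/
def IsLaplacian {d : ℕ} {Ω : Set (EuclideanSpace ℝ (Fin d))} (w : H01 Ω) (g : L2 Ω) : Prop :=
  ∀ φ : H01 Ω, inner ℝ g (toL2 φ) = - inner ℝ (grad w) (grad φ)

/-- The Laplacian `∇²w ∈ L²(Ω)`; it is used only for polynomials `w`, for which it exists,
and it is unique. -/
def laplacian {d : ℕ} {Ω : Set (EuclideanSpace ℝ (Fin d))} (w : H01 Ω) : L2 Ω :=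
  Classical.epsilon (IsLaplacian w)

/-! ### Polynomials in space and time, and the projections -/

/-- `P_M^0(Ω)`: the polynomials of (total) degree at most `M` that vanish on the boundary,
as elements of `H¹₀(Ω)`. -/
def polySpace {d : ℕ} (Ω : Set (EuclideanSpace ℝ (Fin d))) (M : ℕ) : Set (H01 Ω) :=
  {w | ∃ p : MvPolynomial (Fin d) ℝ, p.totalDegree ≤ M ∧
    (∀ x ∈ frontier Ω, MvPolynomial.eval (fun i => x i) p = 0) ∧
    (toL2 w : EuclideanSpace ℝ (Fin d) → ℝ) =ᵐ[volume.restrict Ω]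
      fun x => MvPolynomial.eval (fun i => x i) p}

/-- The polynomials of degree at most `N` in time with coefficients in a set `Y` of a real
vector space, as functions on the whole real line (so that each is its own extension from
any interval). -/
def timePoly {X : Type*} [AddCommGroup X] [Module ℝ X] (N : ℕ) (Y : Set X) : Set (ℝ → X) :=
  {p | ∃ c : ℕ → X, (∀ i, c i ∈ Y) ∧ ∀ t, p t = ∑ i ∈ Finset.range (N + 1), t ^ i • c i}

/-- The discrete space `V_{M,N} = P_M^0(Ω) ⊗ P_N`. -/
def discreteSpace {d : ℕ} (Ω : Set (EuclideanSpace ℝ (Fin d))) (M N : ℕ) : Set (ℝ → H01 Ω) :=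
  timePoly N (polySpace Ω M)

/-- `p` is the elliptic projection of `w` on `P_M^0(Ω)`. -/
def IsSpaceProj {d : ℕ} {Ω : Set (EuclideanSpace ℝ (Fin d))} (M : ℕ) (w p : H01 Ω) : Prop :=
  p ∈ polySpace Ω M ∧ ∀ q ∈ polySpace Ω M, inner ℝ (grad (p - w)) (grad q) = 0

/-- The elliptic projection `Π_M^0 : H¹₀(Ω) → P_M^0(Ω)`; for bounded `Ω` it exists and is unique. -/
def spaceProj {d : ℕ} {Ω : Set (EuclideanSpace ℝ (Fin d))} (M : ℕ) (w : H01 Ω) : H01 Ω :=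
  Classical.epsilon (IsSpaceProj M w)

/-- Linear interpolation in time at the end points of `[a, b]`. -/
def interp {X : Type*} [AddCommGroup X] [Module ℝ X] (a b : ℝ) (u : ℝ → X) (t : ℝ) : X :=
  ((b - t) / (b - a)) • u a + ((t - a) / (b - a)) • u b

/-- `p` is the `H¹₀(a,b)`-projection of `u` (with `u(a) = u(b) = 0`) on the polynomials of
degree at most `N` that vanish at `a` and `b`; functions of time have values in `X`. -/
def IsTimeProjZero {X : Type*} [NormedAddCommGroup X] [NormedSpace ℝ X]
    (N : ℕ) (a b : ℝ) (u p : ℝ → X) : Prop :=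
  p ∈ timePoly N (Set.univ : Set X) ∧ p a = 0 ∧ p b = 0 ∧
  ∀ v : ℝ[X], v.natDegree ≤ N → v.eval a = 0 → v.eval b = 0 →
    ∫ t in a..b, v.derivative.eval t • (deriv u t - deriv p t) = 0

/-- The projection `Π_N^{0}` on `P_N^0([a,b])`; for `a < b` and `u` continuously differentiable
(or in `H¹`) it exists and is unique. -/
def timeProjZero {X : Type*} [NormedAddCommGroup X] [NormedSpace ℝ X]
    (N : ℕ) (a b : ℝ) (u : ℝ → X) : ℝ → X :=
  Classical.epsilon (IsTimeProjZero N a b u)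

/-- The projection `Π_N u = I_1 u + Π_N^0 (u - I_1 u)` in time on the interval `[a,b]`. -/
def timeProj {X : Type*} [NormedAddCommGroup X] [NormedSpace ℝ X]
    (N : ℕ) (a b : ℝ) (u : ℝ → X) : ℝ → X :=
  interp a b u + timeProjZero N a b (u - interp a b u)

/-! ### The exact problem and the scheme -/

/-- `v ∈ H¹(a,b;X)` with time derivative `v' ∈ L²(a,b;X)`. -/
def HasTimeDeriv {X : Type*} [NormedAddCommGroup X] [NormedSpace ℝ X]
    (a b : ℝ) (v v' : ℝ → X) : Prop :=
  MemLp v' 2 (volume.restrict (Icc a b)) ∧ ∀ t ∈ Icc a b, v t = v a + ∫ s in a..t, v' s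

/-- `u ∈ H¹(a,b;H¹₀(Ω))` is a solution of the energetic weak form on `[a,b]`:
`∫_a^b (u_t, v_t) + ε (∇u, ∇v_t) + (1/ε) (f(u), v_t) dt = 0`
for all `v ∈ H¹(a,b;H¹₀(Ω))` with `v(a) = u(a)`. -/
def IsWeakSolution {d : ℕ} {Ω : Set (EuclideanSpace ℝ (Fin d))} (f : ℝ → ℝ) (ε a b : ℝ)
    (u : ℝ → H01 Ω) : Prop :=
  ∃ u' : ℝ → H01 Ω, HasTimeDeriv a b u u' ∧
    ∀ v v' : ℝ → H01 Ω, HasTimeDeriv a b v v' → v a = u a →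
      ∫ t in a..b, (inner ℝ (toL2 (u' t)) (toL2 (v' t))
        + ε * inner ℝ (grad (u t)) (grad (v' t))
        + 1 / ε * nonlinPair f (u t) (v' t)) = 0

/-- `h` is the solution on `[a,b]` of the semi-implicit linear scheme with stabilization
constant `S`, where `g ∈ V_{M,N}` is the numerical solution on the preceding interval, which
ends at `a`: `h ∈ V_{M,N}`, `h(a) = g(a)` and
`∫_a^b (h_t, v_t) + ε (∇h, ∇v_t) + (S/ε) (h, v_t) + (1/ε) (f(g) - S g, v_t) dt = 0`
for all `v ∈ V_{M,N}` with `v(a) = g(a)`. The polynomial `g` is extended to `[a,b]`. -/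
def IsSemiImplicitStep {d : ℕ} {Ω : Set (EuclideanSpace ℝ (Fin d))} (f : ℝ → ℝ) (ε S : ℝ)
    (M N : ℕ) (a b : ℝ) (g h : ℝ → H01 Ω) : Prop :=
  h ∈ discreteSpace Ω M N ∧ h a = g a ∧
    ∀ v ∈ discreteSpace Ω M N, v a = g a →
      ∫ t in a..b, (inner ℝ (toL2 (deriv h t)) (toL2 (deriv v t))
        + ε * inner ℝ (grad (h t)) (grad (deriv v t))
        + S / ε * inner ℝ (toL2 (h t)) (toL2 (deriv v t))
        + 1 / ε * nonlinPair (fun y => f y - S * y) (g t) (deriv v t)) = 0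

/-! ### The Legendre extrapolation constant -/

/-- The Legendre polynomial `L_k` (Rodrigues' formula). -/
def legendre (k : ℕ) : ℝ[X] :=
  C (1 / (2 ^ k * (k.factorial : ℝ))) * derivative^[k] ((X ^ 2 - 1) ^ k)

/-- `c_k = ∫_1^3 L_k² / ∫_{-1}^1 L_k²`. -/
def extrapRatio (k : ℕ) : ℝ :=
  (∫ x in (1 : ℝ)..3, (legendre k).eval x ^ 2) / ∫ x in (-1 : ℝ)..1, (legendre k).eval x ^ 2

/-- `C_m = (∑_{k=0}^m c_k)^{1/2}`. -/
def extrapConst (m : ℕ) : ℝ := √(∑ k ∈ Finset.range (m + 1), extrapRatio k)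

/-! ### The error and projection quantities on the intervals `I_n = [(n-1)τ, nτ]` -/

/-- The node `t_n = n τ`. -/
def node (τ : ℝ) (n : ℕ) : ℝ := n * τ

/-- `‖w‖_n² = ∫_{I_n} ‖w(t)‖² dt`, for `n ≥ 1`. -/
def slabNormSq {d : ℕ} {Ω : Set (EuclideanSpace ℝ (Fin d))} (τ : ℝ) (n : ℕ)
    (w : ℝ → L2 Ω) : ℝ :=
  ∫ t in node τ (n - 1)..node τ n, ‖w t‖ ^ 2

/-- `Π^n u = Π_N^n Π_M^0 u`. -/
def fullProj {d : ℕ} {Ω : Set (EuclideanSpace ℝ (Fin d))} (M N : ℕ) (τ : ℝ) (n : ℕ)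
    (u : ℝ → H01 Ω) : ℝ → H01 Ω :=
  timeProj N (node τ (n - 1)) (node τ n) (fun t => spaceProj M (u t))

/-- `π^n = Π^n u - u`. -/
def projErr {d : ℕ} {Ω : Set (EuclideanSpace ℝ (Fin d))} (M N : ℕ) (τ : ℝ) (n : ℕ)
    (u : ℝ → H01 Ω) (t : ℝ) : H01 Ω :=
  fullProj M N τ n u t - u t

/-- `π_M^n = (Π_M^0 - I) Π_N^n u`. -/
def projErrSpace {d : ℕ} {Ω : Set (EuclideanSpace ℝ (Fin d))} (M N : ℕ) (τ : ℝ) (n : ℕ)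
    (u : ℝ → H01 Ω) (t : ℝ) : H01 Ω :=
  spaceProj M (timeProj N (node τ (n - 1)) (node τ n) u t)
    - timeProj N (node τ (n - 1)) (node τ n) u t

/-- `π_N^n = (Π_N^n - I) Π_M^0 u`. -/
def projErrTime {d : ℕ} {Ω : Set (EuclideanSpace ℝ (Fin d))} (M N : ℕ) (τ : ℝ) (n : ℕ)
    (u : ℝ → H01 Ω) (t : ℝ) : H01 Ω :=
  fullProj M N τ n u t - spaceProj M (u t)

/-- `Π̂^n u = T_N^n Π_M^0 u`: the Taylor polynomial in time of degree `N` of `Π_M^0 u`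
at `t_{n-1}`, for `u` given on the time interval `[0,T]`. -/
def taylorProj {d : ℕ} {Ω : Set (EuclideanSpace ℝ (Fin d))} (M N : ℕ) (T τ : ℝ) (n : ℕ)
    (u : ℝ → H01 Ω) (t : ℝ) : H01 Ω :=
  taylorWithinEval (fun s => spaceProj M (u s)) N (Icc 0 T) (node τ (n - 1)) t

/-- `π̂^n = Π̂^n u - u`. -/
def taylorErr {d : ℕ} {Ω : Set (EuclideanSpace ℝ (Fin d))} (M N : ℕ) (T τ : ℝ) (n : ℕ)
    (u : ℝ → H01 Ω) (t : ℝ) : H01 Ω :=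
  taylorProj M N T τ n u t - u t

/-- `ρ^n = h^n - Π^n u`. -/
def rho {d : ℕ} {Ω : Set (EuclideanSpace ℝ (Fin d))} (M N : ℕ) (τ : ℝ)
    (u : ℝ → H01 Ω) (h : ℕ → ℝ → H01 Ω) (n : ℕ) (t : ℝ) : H01 Ω :=
  h n t - fullProj M N τ n u t

/-- `D_τ = (ε/L) (1/4 - 4 τ² L² (1 + 6 C_{N-1}²) / ε²)`. -/
def Dtau (ε L τ : ℝ) (N : ℕ) : ℝ :=
  ε / L * (1 / 4 - 4 * τ ^ 2 * L ^ 2 * (1 + 6 * extrapConst (N - 1) ^ 2) / ε ^ 2)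

/-- `D_2 = 8 L / ε`. -/
def D2 (ε L : ℝ) : ℝ := 8 * L / ε

/-- `D_3 = 24 L τ C_{N-1}² / ε`. -/
def D3 (ε L τ : ℝ) (N : ℕ) : ℝ := 24 * L * τ * extrapConst (N - 1) ^ 2 / ε

/-- The projection quantity `Ê_p^k`, for `k ≥ 2`. -/
def Ehat {d : ℕ} {Ω : Set (EuclideanSpace ℝ (Fin d))} (ε L S : ℝ) (M N : ℕ) (T τ : ℝ)
    (u : ℝ → H01 Ω) (k : ℕ) : ℝ :=
  ε / L *
    (6 * slabNormSq τ k (fun t => toL2 (deriv (projErrSpace M N τ k u) t)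
        + (S / ε) • toL2 (projErr M N τ k u t))
      + 6 * ε ^ 2 * slabNormSq τ k (fun t => laplacian (projErrTime M N τ k u t))
      + 4 * L ^ 2 * τ / ε ^ 2 * ‖toL2 (projErr M N τ k u (node τ (k - 1)))‖ ^ 2
      + 12 * L ^ 2 * τ ^ 2 * extrapConst (N - 1) ^ 2 / ε ^ 2 *
        (slabNormSq τ k (fun t => toL2 (deriv (taylorErr M N T τ k u) t))
          + 2 * slabNormSq τ (k - 1)
              (fun t => toL2 (deriv (fun s => taylorProj M N T τ k u s
                - fullProj M N τ (k - 1) u s) t))))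

end ESET

end

open ESET

namespace ESET

/-! ### Legendre polynomials -/

/-! The proof is an energy argument on each time interval, closed by a discrete Gronwall inequality.

Both the scheme and the weak form see a test function only through its time derivative, so the
prescribed initial value costs nothing: a constant is added to `ρ`, and both equations are tested
with `v_t = ρ_t`. Subtracting them leaves the square of `ρ_t`, the exact derivatives `(∇ρ, ∇ρ_t)`
and `(ρ, ρ_t)`, and projection errors. The time projection commutes with the elliptic projection
(`timeProj_map`), so `Π u - u` can be split in either order. For the time derivative, the part from
`Π_N u - u` integrates to zero against `ρ_t`, which has degree at most `N - 1` in time. For the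
gradient, the part from `Π_M^0 u - u` is orthogonal to `∇ρ_t`, and the rest is turned into a
Laplacian. The function `f y - S * y` is `L`-Lipschitz. Young's inequality then gives
`energy_inequality`, with `3/4` of the square of `ρ_t` left over.

What remains is `ĥ - u`, where `ĥ` is the extrapolated previous solution. It equals `ρ + π` at the
left node, plus an integral of `(ĥ - u)_t`. There the Taylor polynomial `p` of `Π_M^0 u` is
inserted: `(ĥ - p)_t` is a polynomial of degree at most `N - 1` in time, so its norm on the new
interval is at most `C_{N-1}` times its norm on the old one (`extrapolation`, by Legendre expansion
and Cauchy-Schwarz). On the old interval it is `ρ_t` plus projection errors. This is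
`integral_deriv_extrapolation_le`.

The `L²` norm of `ρ` at the right node is controlled by its value at the left node and by `ρ_t`
(`endpoint_norm_bound`). Combining these bounds (`step_algebra`) yields a recursion from one node to
the next with growth factor `1 + D_2 τ`, and `discrete_gronwall` sums it.

The remaining work shows that the projections, chosen by `Classical.epsilon`, have the properties
used: existence, uniqueness, linearity, and continuity in time. -/

theorem natDegree_legendre_le (k : ℕ) : (legendre k).natDegree ≤ k := by
  unfold legendre
  refine (natDegree_C_mul_le _ _).trans ((natDegree_iterate_derivative _ _).trans ?_)
  have h : ((X ^ 2 - 1 : ℝ[X]) ^ k).natDegree ≤ k * 2 :=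
    natDegree_pow_le.trans (Nat.mul_le_mul_left k (by compute_degree))
  omega

theorem coeff_legendre_ne_zero (k : ℕ) : (legendre k).coeff k ≠ 0 := by
  have hm : (X ^ 2 - 1 : ℝ[X]).Monic := by monicity!
  have hd : (X ^ 2 - 1 : ℝ[X]).natDegree = 2 := by compute_degree!
  have h1 : ((X ^ 2 - 1 : ℝ[X]) ^ k).coeff (k + k) = 1 := by
    have h2 : ((X ^ 2 - 1 : ℝ[X]) ^ k).natDegree = k + k := by
      rw [hm.natDegree_pow, hd]; ring
    rw [← h2]; exact (hm.pow k).coeff_natDegree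
  unfold legendre
  rw [coeff_C_mul, coeff_iterate_derivative, h1]
  have h3 : (k + k).descFactorial k ≠ 0 := by
    rw [Ne, Nat.descFactorial_eq_zero_iff_lt]; omega
  have h4 : (k.factorial : ℝ) ≠ 0 := by positivity
  have h5 : (((k + k).descFactorial k : ℕ) : ℝ) ≠ 0 := by exact_mod_cast h3
  rw [nsmul_eq_mul, mul_one]
  positivity

/-- Integration by parts for polynomials. -/
theorem integral_derivative_mul (p q : ℝ[X]) (a b : ℝ) :
    ∫ x in a..b, (derivative p).eval x * q.eval x =
      p.eval b * q.eval b - p.eval a * q.eval a - ∫ x in a..b, p.eval x * (derivative q).eval x :=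
  eq_sub_of_add_eq' (by
    rw [intervalIntegral.integral_mul_deriv_eq_deriv_mul
      (fun x _ => p.hasDerivAt x) (fun x _ => q.hasDerivAt x)
      ((derivative p).continuous.intervalIntegrable _ _)
      ((derivative q).continuous.intervalIntegrable _ _)]
    ring)

/-- Integrate by parts `m` times. The boundary terms vanish because `1` and `-1` are zeros of order
`k` of `(X ^ 2 - 1) ^ k`, so derivatives of order below `k` are zero there. Letting `m` vary below
`k` is what makes the induction run. -/
theorem integral_iterate_derivative_mul_eq_zero (k : ℕ) :
    ∀ m ≤ k, ∀ q : ℝ[X], derivative^[m] q = 0 →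
      ∫ x in (-1 : ℝ)..1, (derivative^[m] ((X ^ 2 - 1 : ℝ[X]) ^ k)).eval x * q.eval x = 0 := by
  intro m
  induction m with
  | zero =>
    intro _ q hq
    simp only [Function.iterate_zero, id] at hq
    simp [hq]
  | succ m ih =>
    intro hm q hq
    have hroot : ∀ x : ℝ, x ^ 2 - 1 = 0 →
        (derivative^[m] ((X ^ 2 - 1 : ℝ[X]) ^ k)).eval x = 0 := by
      intro x hx
      obtain ⟨r, hr⟩ := pow_sub_dvd_iterate_derivative_pow (X ^ 2 - 1 : ℝ[X]) k m
      have : k - m ≠ 0 := by omega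
      rw [hr]
      simp [hx, this]
    simp only [Function.iterate_succ_apply']
    rw [integral_derivative_mul, hroot 1 (by norm_num), hroot (-1) (by norm_num),
      ih (by omega) (derivative q) (by rwa [← Function.iterate_succ_apply])]
    simp

theorem integral_legendre_mul_eq_zero {k : ℕ} {q : ℝ[X]} (hq : q.natDegree < k) :
    ∫ x in (-1 : ℝ)..1, (legendre k).eval x * q.eval x = 0 := by
  have h := integral_iterate_derivative_mul_eq_zero k k le_rfl q
    (iterate_derivative_eq_zero hq)
  unfold legendre
  simp only [eval_mul, eval_C, mul_assoc, intervalIntegral.integral_const_mul, h, mul_zero]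

theorem integral_legendre_mul_legendre {j k : ℕ} (hjk : j ≠ k) :
    ∫ x in (-1 : ℝ)..1, (legendre j).eval x * (legendre k).eval x = 0 := by
  rcases lt_or_gt_of_ne hjk with h | h
  · simp only [mul_comm ((legendre j).eval _)]
    exact integral_legendre_mul_eq_zero ((natDegree_legendre_le j).trans_lt h)
  · exact integral_legendre_mul_eq_zero ((natDegree_legendre_le k).trans_lt h)

theorem integral_eval_sq_pos {p : ℝ[X]} (hp : p ≠ 0) {a b : ℝ} (hab : a < b) :
    0 < ∫ x in a..b, p.eval x ^ 2 := by
  have hex : ∃ c ∈ Icc a b, p.eval c ≠ 0 := by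
    by_contra! hcon
    refine hp (p.eq_zero_of_infinite_isRoot ((Icc_infinite hab).mono fun x hx => hcon x hx))
  obtain ⟨c, hc, hpc⟩ := hex
  exact intervalIntegral.integral_pos hab (by fun_prop) (fun x _ => sq_nonneg _)
    ⟨c, hc, by positivity⟩

theorem legendre_ne_zero (k : ℕ) : legendre k ≠ 0 := fun h =>
  coeff_legendre_ne_zero k (by simp [h])

/-- The basis is triangular: `legendre n` has a nonzero coefficient of `X ^ n`, so a multiple of it
removes the top term of `q`. -/
theorem exists_legendre_expansion (n : ℕ) (q : ℝ[X]) (hq : q.degree < n) :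
    ∃ c : ℕ → ℝ, q = ∑ k ∈ Finset.range n, C (c k) * legendre k := by
  induction n generalizing q with
  | zero =>
    refine ⟨0, ?_⟩
    rw [Finset.range_zero, Finset.sum_empty, ← degree_eq_bot]
    simpa using hq
  | succ n ih =>
    set r := q - C (q.coeff n / (legendre n).coeff n) * legendre n with hr
    have hdeg : r.degree < n := by
      rw [degree_lt_iff_coeff_zero] at hq ⊢
      intro m hm
      rcases hm.eq_or_lt with rfl | hlt
      · simp [hr, div_mul_cancel₀ _ (coeff_legendre_ne_zero n)]
      · have : (legendre n).coeff m = 0 :=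
          coeff_eq_zero_of_natDegree_lt ((natDegree_legendre_le n).trans_lt hlt)
        simp [hr, this, hq m hlt]
    obtain ⟨c, hc⟩ := ih r hdeg
    refine ⟨fun k => if k = n then q.coeff n / (legendre n).coeff n else c k, ?_⟩
    rw [Finset.sum_range_succ]
    have : ∑ k ∈ Finset.range n, C (if k = n then q.coeff n / (legendre n).coeff n else c k) *
        legendre k = r := by
      rw [hc]
      refine Finset.sum_congr rfl fun k hk => ?_
      rw [if_neg (Finset.mem_range.1 hk).ne]
    rw [this]
    simp [hr]

/-! ### Legendre polynomials on an interval -/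

/-- The Legendre polynomial transported affinely from `[-1, 1]` to `[a, b]`. -/
noncomputable def scaledLegendre (a b : ℝ) (k : ℕ) : ℝ[X] :=
  (legendre k).comp (C (2 / (b - a)) * X - C ((a + b) / (b - a)))

theorem eval_scaledLegendre (a b : ℝ) (k : ℕ) (t : ℝ) :
    (scaledLegendre a b k).eval t = (legendre k).eval (2 / (b - a) * t - (a + b) / (b - a)) := by
  simp [scaledLegendre]

theorem integral_affine {a b : ℝ} (hab : a < b) (F : ℝ → ℝ) :
    ∫ t in a..b, F (2 / (b - a) * t - (a + b) / (b - a)) =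
      (b - a) / 2 * ∫ x in (-1 : ℝ)..1, F x := by
  have h : b - a ≠ 0 := (sub_pos.2 hab).ne'
  rw [intervalIntegral.integral_comp_mul_sub F (by positivity)]
  rw [show 2 / (b - a) * a - (a + b) / (b - a) = -1 by field_simp; ring,
    show 2 / (b - a) * b - (a + b) / (b - a) = 1 by field_simp; ring]
  simp

/-- The affine map that sends `[a, b]` to `[-1, 1]` sends the next interval to `[1, 3]`; this is
where the limits in `extrapRatio` come from. -/
theorem integral_affine_next {a b : ℝ} (hab : a < b) (F : ℝ → ℝ) :
    ∫ t in b..(2 * b - a), F (2 / (b - a) * t - (a + b) / (b - a)) =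
      (b - a) / 2 * ∫ x in (1 : ℝ)..3, F x := by
  have h : b - a ≠ 0 := (sub_pos.2 hab).ne'
  rw [intervalIntegral.integral_comp_mul_sub F (by positivity)]
  rw [show 2 / (b - a) * b - (a + b) / (b - a) = 1 by field_simp; ring,
    show 2 / (b - a) * (2 * b - a) - (a + b) / (b - a) = 3 by field_simp; ring]
  simp

theorem integral_scaledLegendre_mul {a b : ℝ} (hab : a < b) {j k : ℕ} (hjk : j ≠ k) :
    ∫ t in a..b, (scaledLegendre a b j).eval t * (scaledLegendre a b k).eval t = 0 := by
  simp only [eval_scaledLegendre]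
  rw [integral_affine hab (fun x => (legendre j).eval x * (legendre k).eval x),
    integral_legendre_mul_legendre hjk, mul_zero]

theorem integral_scaledLegendre_sq {a b : ℝ} (hab : a < b) (k : ℕ) :
    ∫ t in a..b, (scaledLegendre a b k).eval t ^ 2 =
      (b - a) / 2 * ∫ x in (-1 : ℝ)..1, (legendre k).eval x ^ 2 := by
  simp only [eval_scaledLegendre]
  exact integral_affine hab (fun x => (legendre k).eval x ^ 2)

theorem integral_scaledLegendre_sq_pos {a b : ℝ} (hab : a < b) (k : ℕ) :
    0 < ∫ t in a..b, (scaledLegendre a b k).eval t ^ 2 := by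
  rw [integral_scaledLegendre_sq hab]
  exact mul_pos (by linarith) (integral_eval_sq_pos (legendre_ne_zero k) (by norm_num))

theorem integral_scaledLegendre_sq_next {a b : ℝ} (hab : a < b) (k : ℕ) :
    ∫ t in b..(2 * b - a), (scaledLegendre a b k).eval t ^ 2 =
      extrapRatio k * ∫ t in a..b, (scaledLegendre a b k).eval t ^ 2 := by
  rw [integral_scaledLegendre_sq hab]
  simp only [eval_scaledLegendre]
  rw [integral_affine_next hab (fun x => (legendre k).eval x ^ 2), extrapRatio]
  have := integral_eval_sq_pos (legendre_ne_zero k) (show (-1 : ℝ) < 1 by norm_num)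
  field_simp

theorem exists_scaledLegendre_expansion {a b : ℝ} (hab : a < b) (n : ℕ) (q : ℝ[X])
    (hq : q.degree < n) :
    ∃ c : ℕ → ℝ, ∀ t, q.eval t =
      ∑ k ∈ Finset.range n, c k * (scaledLegendre a b k).eval t := by
  have h : b - a ≠ 0 := (sub_pos.2 hab).ne'
  set A : ℝ[X] := C ((b - a) / 2) * X + C ((a + b) / 2) with hA
  have hAdeg : A.natDegree ≤ 1 := natDegree_linear_le
  have hdeg : (q.comp A).degree < n := by
    by_cases hq0 : q = 0
    · simp [hq0]
    rw [← natDegree_lt_iff_degree_lt hq0] at hq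
    refine (degree_le_natDegree).trans_lt ?_
    have h1 : (q.comp A).natDegree ≤ q.natDegree * 1 :=
      natDegree_comp_le.trans (Nat.mul_le_mul_left _ hAdeg)
    exact_mod_cast (h1.trans_lt (by simpa using hq))
  obtain ⟨c, hc⟩ := exists_legendre_expansion n _ hdeg
  refine ⟨c, fun t => ?_⟩
  have h2 := congrArg (eval (2 / (b - a) * t - (a + b) / (b - a))) hc
  rw [eval_comp, eval_finsetSum] at h2
  simp only [eval_mul, eval_C, hA, eval_add, eval_X] at h2
  rw [show (b - a) / 2 * (2 / (b - a) * t - (a + b) / (b - a)) + (a + b) / 2 = t by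
    field_simp; ring] at h2
  rw [h2]
  simp only [eval_scaledLegendre]

theorem degree_scaledLegendre_lt (a b : ℝ) {k n : ℕ} (hk : k < n) :
    (scaledLegendre a b k).degree < n := by
  refine degree_le_natDegree.trans_lt ?_
  have h1 : (scaledLegendre a b k).natDegree ≤ k * 1 := by
    refine natDegree_comp_le.trans (Nat.mul_le_mul (natDegree_legendre_le k) ?_)
    rw [sub_eq_add_neg, ← C_neg]
    exact natDegree_linear_le
  exact_mod_cast (by omega : (scaledLegendre a b k).natDegree < n)

theorem extrapRatio_nonneg (k : ℕ) : 0 ≤ extrapRatio k :=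
  div_nonneg (intervalIntegral.integral_nonneg (by norm_num) fun _ _ => sq_nonneg _)
    (intervalIntegral.integral_nonneg (by norm_num) fun _ _ => sq_nonneg _)

theorem extrapConst_sq (m : ℕ) :
    extrapConst m ^ 2 = ∑ k ∈ Finset.range (m + 1), extrapRatio k :=
  Real.sq_sqrt (Finset.sum_nonneg fun k _ => extrapRatio_nonneg k)

/-- The term `k = 0` alone is `1`, since the constant polynomial has the same integral over `[1, 3]`
and `[-1, 1]`. In `step_algebra` this lets the Taylor error carry the factor `C_{N-1}²`. -/
theorem one_le_extrapConst_sq (m : ℕ) : 1 ≤ extrapConst m ^ 2 := by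
  rw [extrapConst_sq, Finset.sum_range_succ']
  have h0 : extrapRatio 0 = 1 := by
    simp [extrapRatio, legendre]; norm_num
  rw [h0]
  have := Finset.sum_nonneg fun k (_ : k ∈ Finset.range m) => extrapRatio_nonneg (k + 1)
  linarith

/-! ### Polynomials in time with values in a vector space -/

section TimePoly

variable {V : Type*} [NormedAddCommGroup V] [NormedSpace ℝ V]

theorem eval_eq_sum_lt {q : ℝ[X]} {n : ℕ} (hq : q.degree < n) (t : ℝ) :
    q.eval t = ∑ i ∈ Finset.range n, q.coeff i * t ^ i := by
  by_cases h0 : q = 0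
  · simp [h0]
  · exact eval_eq_sum_range' ((natDegree_lt_iff_degree_lt h0).2 hq) t

theorem timePoly_add {Y : Submodule ℝ V} {n : ℕ} {p q : ℝ → V}
    (hp : p ∈ timePoly n (Y : Set V)) (hq : q ∈ timePoly n (Y : Set V)) :
    p + q ∈ timePoly n (Y : Set V) := by
  obtain ⟨c, hc, hpc⟩ := hp
  obtain ⟨e, he, hqe⟩ := hq
  refine ⟨fun i => c i + e i, fun i => Y.add_mem (hc i) (he i), fun t => ?_⟩
  simp [hpc, hqe, Finset.sum_add_distrib]

theorem timePoly_neg {Y : Submodule ℝ V} {n : ℕ} {p : ℝ → V}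
    (hp : p ∈ timePoly n (Y : Set V)) : -p ∈ timePoly n (Y : Set V) := by
  obtain ⟨c, hc, hpc⟩ := hp
  exact ⟨fun i => -c i, fun i => Y.neg_mem (hc i), fun t => by simp [hpc]⟩

theorem timePoly_sub {Y : Submodule ℝ V} {n : ℕ} {p q : ℝ → V}
    (hp : p ∈ timePoly n (Y : Set V)) (hq : q ∈ timePoly n (Y : Set V)) :
    p - q ∈ timePoly n (Y : Set V) := by
  rw [sub_eq_add_neg]; exact timePoly_add hp (timePoly_neg hq)

theorem timePoly_sum {Y : Submodule ℝ V} {n : ℕ} {ι : Type*} (s : Finset ι) {p : ι → ℝ → V}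
    (hp : ∀ i ∈ s, p i ∈ timePoly n (Y : Set V)) :
    (fun t => ∑ i ∈ s, p i t) ∈ timePoly n (Y : Set V) := by
  classical
  induction s using Finset.induction_on with
  | empty => exact ⟨0, fun i => Y.zero_mem, fun t => by simp⟩
  | insert i s hi ih =>
    simp only [Finset.sum_insert hi]
    exact timePoly_add (hp i (Finset.mem_insert_self _ _))
      (ih fun j hj => hp j (Finset.mem_insert_of_mem hj))

theorem timePoly_eval_smul {Y : Submodule ℝ V} {n : ℕ} {q : ℝ[X]} (hq : q.degree < (n + 1 : ℕ))
    {x : V} (hx : x ∈ Y) : (fun t => q.eval t • x) ∈ timePoly n (Y : Set V) := by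
  refine ⟨fun i => q.coeff i • x, fun i => Y.smul_mem _ hx, fun t => ?_⟩
  simp only [eval_eq_sum_lt hq, Finset.sum_smul, smul_smul, mul_comm]

theorem timePoly_const {Y : Submodule ℝ V} (n : ℕ) {x : V} (hx : x ∈ Y) :
    (fun _ => x) ∈ timePoly n (Y : Set V) := by
  simpa using timePoly_eval_smul (n := n) (q := 1) (by
    rw [degree_one]; exact_mod_cast Nat.succ_pos n) hx

theorem timePoly_mono {Y Z : Set V} (h : Y ⊆ Z) {n : ℕ} {p : ℝ → V} (hp : p ∈ timePoly n Y) :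
    p ∈ timePoly n Z := by
  obtain ⟨c, hc, hpc⟩ := hp
  exact ⟨c, fun i => h (hc i), hpc⟩

theorem timePoly_mem {Y : Submodule ℝ V} {n : ℕ} {p : ℝ → V} (hp : p ∈ timePoly n (Y : Set V))
    (t : ℝ) : p t ∈ Y := by
  obtain ⟨c, hc, hpc⟩ := hp
  rw [hpc]
  exact Y.sum_mem fun i _ => Y.smul_mem _ (hc i)

theorem timePoly_map {Z : Type*} [NormedAddCommGroup Z] [NormedSpace ℝ Z] (A : V →ₗ[ℝ] Z)
    {Y : Set V} {W : Set Z} (hA : ∀ y ∈ Y, A y ∈ W) {n : ℕ} {p : ℝ → V}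
    (hp : p ∈ timePoly n Y) : (fun t => A (p t)) ∈ timePoly n W := by
  obtain ⟨c, hc, hpc⟩ := hp
  exact ⟨fun i => A (c i), fun i => hA _ (hc i), fun t => by simp [hpc]⟩

theorem timePoly_continuous {Y : Set V} {n : ℕ} {p : ℝ → V} (hp : p ∈ timePoly n Y) :
    Continuous p := by
  obtain ⟨c, -, hpc⟩ := hp
  rw [funext hpc]
  fun_prop

theorem timePoly_exists_hasDerivAt {Y : Submodule ℝ V} {m : ℕ} {p : ℝ → V}
    (hp : p ∈ timePoly (m + 1) (Y : Set V)) :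
    ∃ q ∈ timePoly m (Y : Set V), ∀ t, HasDerivAt p (q t) t := by
  obtain ⟨c, hc, hpc⟩ := hp
  refine ⟨fun t => ∑ i ∈ Finset.range (m + 1), t ^ i • ((i + 1 : ℝ) • c (i + 1)),
    ⟨_, fun i => Y.smul_mem _ (hc _), fun t => rfl⟩, fun t => ?_⟩
  rw [funext hpc]
  have h : HasDerivAt (fun t : ℝ => ∑ i ∈ Finset.range (m + 1 + 1), t ^ i • c i)
      (∑ i ∈ Finset.range (m + 1 + 1), ((i : ℝ) * t ^ (i - 1)) • c i) t :=
    HasDerivAt.fun_sum fun i _ => (hasDerivAt_pow i t).smul_const (c i)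
  convert h using 1
  rw [Finset.sum_range_succ' _ (m + 1)]
  simp [smul_smul, mul_comm]

theorem timePoly_deriv_mem {Y : Submodule ℝ V} {m : ℕ} {p : ℝ → V}
    (hp : p ∈ timePoly (m + 1) (Y : Set V)) : deriv p ∈ timePoly m (Y : Set V) := by
  obtain ⟨q, hq, h⟩ := timePoly_exists_hasDerivAt hp
  rwa [show deriv p = q from funext fun t => (h t).deriv]

theorem timePoly_hasDerivAt {Y : Submodule ℝ V} {m : ℕ} {p : ℝ → V}
    (hp : p ∈ timePoly (m + 1) (Y : Set V)) (t : ℝ) : HasDerivAt p (deriv p t) t := by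
  obtain ⟨q, hq, h⟩ := timePoly_exists_hasDerivAt hp
  exact (h t).differentiableAt.hasDerivAt

theorem timePoly_legendre_expansion {Y : Submodule ℝ V} {a b : ℝ} (hab : a < b) {m : ℕ}
    {p : ℝ → V} (hp : p ∈ timePoly m (Y : Set V)) :
    ∃ e : ℕ → V, ∀ t, p t = ∑ k ∈ Finset.range (m + 1), (scaledLegendre a b k).eval t • e k := by
  obtain ⟨c, -, hpc⟩ := hp
  have h : ∀ i ∈ Finset.range (m + 1), ∃ α : ℕ → ℝ, ∀ t : ℝ, t ^ i =
      ∑ k ∈ Finset.range (m + 1), α k * (scaledLegendre a b k).eval t := by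
    intro i hi
    obtain ⟨α, hα⟩ := exists_scaledLegendre_expansion hab (m + 1) (X ^ i) (by
      rw [degree_X_pow]; exact_mod_cast Finset.mem_range.1 hi)
    exact ⟨α, fun t => by simpa using hα t⟩
  choose! α hα using h
  refine ⟨fun k => ∑ i ∈ Finset.range (m + 1), α i k • c i, fun t => ?_⟩
  rw [hpc]
  simp only [Finset.smul_sum]
  rw [Finset.sum_comm]
  refine Finset.sum_congr rfl fun i hi => ?_
  rw [hα i hi t, Finset.sum_smul]
  refine Finset.sum_congr rfl fun k _ => ?_
  rw [smul_smul, mul_comm]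

end TimePoly

/-- Extrapolation of a polynomial of degree at most `m` from `[a, b]` to the next interval of the
same length. -/
theorem extrapolation {H : Type*} [NormedAddCommGroup H] [InnerProductSpace ℝ H]
    {a b : ℝ} (hab : a < b) {m : ℕ} {p : ℝ → H} (hp : p ∈ timePoly m (univ : Set H)) :
    ∫ t in b..(2 * b - a), ‖p t‖ ^ 2 ≤ extrapConst m ^ 2 * ∫ t in a..b, ‖p t‖ ^ 2 := by
  obtain ⟨e, he⟩ := timePoly_legendre_expansion (Y := ⊤) hab (by simpa using hp)
  set ℓ : ℕ → ℝ → ℝ := fun k t => (scaledLegendre a b k).eval t with hℓ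
  have hcont : ∀ k, Continuous (ℓ k) := fun k => (scaledLegendre a b k).continuous
  set n : ℕ → ℝ := fun k => ∫ t in a..b, ℓ k t ^ 2 with hn
  have hnpos : ∀ k, 0 < n k := fun k => integral_scaledLegendre_sq_pos hab k
  -- Parseval's identity for the orthogonal system `ℓ k` with vector coefficients.
  have hnorm : ∫ t in a..b, ‖p t‖ ^ 2 = ∑ k ∈ Finset.range (m + 1), n k * ‖e k‖ ^ 2 := by
    have h1 : ∀ t, ‖p t‖ ^ 2 = ∑ j ∈ Finset.range (m + 1), ∑ k ∈ Finset.range (m + 1),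
        ℓ j t * ℓ k t * inner ℝ (e j) (e k) := by
      intro t
      rw [← real_inner_self_eq_norm_sq, he, sum_inner]
      refine Finset.sum_congr rfl fun j _ => ?_
      rw [inner_sum]
      refine Finset.sum_congr rfl fun k _ => ?_
      rw [real_inner_smul_left, real_inner_smul_right]
      ring
    simp only [h1]
    rw [intervalIntegral.integral_finsetSum fun j _ =>
      Continuous.intervalIntegrable (by fun_prop) _ _]
    refine Finset.sum_congr rfl fun j hj => ?_
    rw [intervalIntegral.integral_finsetSum fun k _ =>
      Continuous.intervalIntegrable (by fun_prop) _ _]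
    rw [Finset.sum_eq_single j]
    · rw [intervalIntegral.integral_mul_const, real_inner_self_eq_norm_sq, hn]
      simp only [pow_two]
    · intro k _ hk
      rw [intervalIntegral.integral_mul_const, hℓ, integral_scaledLegendre_mul hab hk.symm,
        zero_mul]
    · exact fun h => absurd hj h
  -- Cauchy-Schwarz with weights `n k`, at any real `t`, inside the interval or not. Integrating
  -- over the next interval turns each `ℓ k t ^ 2 / n k` into `extrapRatio k`.
  have hpt : ∀ t, ‖p t‖ ^ 2 ≤
      (∑ k ∈ Finset.range (m + 1), ℓ k t ^ 2 / n k) * ∫ t in a..b, ‖p t‖ ^ 2 := by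
    intro t
    rw [hnorm]
    have h1 : ‖p t‖ ≤ ∑ k ∈ Finset.range (m + 1), |ℓ k t| * ‖e k‖ := by
      rw [he]
      refine (norm_sum_le _ _).trans (Finset.sum_le_sum fun k _ => ?_)
      rw [norm_smul, Real.norm_eq_abs]
    refine (pow_le_pow_left₀ (norm_nonneg _) h1 2).trans ?_
    refine Finset.sum_sq_le_sum_mul_sum_of_sq_le_mul _ (fun k _ => by have := hnpos k; positivity)
      (fun k _ => by have := hnpos k; positivity) fun k _ => ?_
    have := (hnpos k).ne'
    rw [mul_pow, sq_abs]
    exact le_of_eq (by field_simp)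
  have hpc := timePoly_continuous hp
  calc ∫ t in b..(2 * b - a), ‖p t‖ ^ 2
      ≤ ∫ t in b..(2 * b - a), (∑ k ∈ Finset.range (m + 1), ℓ k t ^ 2 / n k) *
          ∫ t in a..b, ‖p t‖ ^ 2 := by
        refine intervalIntegral.integral_mono_on (by linarith)
          (Continuous.intervalIntegrable (by fun_prop) _ _)
          (Continuous.intervalIntegrable ?_ _ _) fun t _ => hpt t
        exact (continuous_finsetSum _ fun k _ =>
          ((hcont k).pow 2).div_const _).mul_const _
    _ = extrapConst m ^ 2 * ∫ t in a..b, ‖p t‖ ^ 2 := by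
        rw [intervalIntegral.integral_mul_const, extrapConst_sq,
          intervalIntegral.integral_finsetSum fun k _ => Continuous.intervalIntegrable
            (u := fun t => ℓ k t ^ 2 / n k) (((hcont k).pow 2).div_const _) _ _]
        congr 1
        refine Finset.sum_congr rfl fun k _ => ?_
        rw [intervalIntegral.integral_div, hℓ, integral_scaledLegendre_sq_next hab]
        exact mul_div_cancel_right₀ _ (hnpos k).ne'

/-! ### Continuously differentiable functions on a closed interval -/

/-- `u` is continuous on `[a, b]` and differentiable on `(a, b)`, with derivative `u'` continuous
on `[a, b]`. -/
structure C1On {V : Type*} [NormedAddCommGroup V] [NormedSpace ℝ V] (a b : ℝ) (u u' : ℝ → V) :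
    Prop where
  hasDerivAt : ∀ t ∈ Ioo a b, HasDerivAt u (u' t) t
  cont : ContinuousOn u (Icc a b)
  cont' : ContinuousOn u' (Icc a b)

section

variable {V : Type*} [NormedAddCommGroup V] [NormedSpace ℝ V] {a b : ℝ} {u u' v v' : ℝ → V}

theorem C1On.of_hasDerivAt (h : ∀ t, HasDerivAt u (u' t) t) (hc : Continuous u') :
    C1On a b u u' :=
  ⟨fun t _ => h t, (continuous_iff_continuousAt.2 fun t => (h t).continuousAt).continuousOn,
    hc.continuousOn⟩

theorem C1On.of_timePoly {Y : Submodule ℝ V} {m : ℕ} {p : ℝ → V}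
    (hp : p ∈ timePoly (m + 1) (Y : Set V)) : C1On a b p (deriv p) :=
  C1On.of_hasDerivAt (timePoly_hasDerivAt hp) (timePoly_continuous (timePoly_deriv_mem hp))

theorem C1On.sub (hu : C1On a b u u') (hv : C1On a b v v') : C1On a b (u - v) (u' - v') :=
  ⟨fun t ht => (hu.hasDerivAt t ht).sub (hv.hasDerivAt t ht), hu.cont.sub hv.cont,
    hu.cont'.sub hv.cont'⟩

theorem C1On.map {Z : Type*} [NormedAddCommGroup Z] [NormedSpace ℝ Z] (A : V →L[ℝ] Z)
    (hu : C1On a b u u') : C1On a b (fun t => A (u t)) (fun t => A (u' t)) :=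
  ⟨fun t ht => (A.hasFDerivAt.comp_hasDerivAt t (hu.hasDerivAt t ht)),
    A.continuous.comp_continuousOn hu.cont, A.continuous.comp_continuousOn hu.cont'⟩

theorem C1On.ae_deriv (hu : C1On a b u u') : ∀ᵐ t, t ∈ Ioc a b → deriv u t = u' t := by
  have h : ∀ᵐ t : ℝ, t ≠ b := by simp [ae_iff, measure_singleton]
  filter_upwards [h] with t ht hmem
  exact (hu.hasDerivAt t ⟨hmem.1, lt_of_le_of_ne hmem.2 ht⟩).deriv

/-- `deriv u` is two-sided and need not equal `u'` at the end points, where nothing is known of `u`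
beyond the interval; this is a null set. -/
theorem C1On.integral_congr {Z : Type*} [NormedAddCommGroup Z] [NormedSpace ℝ Z]
    (hu : C1On a b u u') (hab : a ≤ b) (F : ℝ → V → Z) :
    ∫ t in a..b, F t (deriv u t) = ∫ t in a..b, F t (u' t) := by
  refine intervalIntegral.integral_congr_ae ?_
  rw [uIoc_of_le hab]
  filter_upwards [hu.ae_deriv] with t ht hmem
  rw [ht hmem]

theorem C1On.mono {c d : ℝ} (hu : C1On a b u u') (hac : a ≤ c) (hdb : d ≤ b) : C1On c d u u' :=
  ⟨fun t ht => hu.hasDerivAt t ⟨hac.trans_lt ht.1, ht.2.trans_le hdb⟩,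
    hu.cont.mono (Icc_subset_Icc hac hdb), hu.cont'.mono (Icc_subset_Icc hac hdb)⟩

variable [CompleteSpace V]

theorem C1On.integral_eq_sub (hu : C1On a b u u') (hab : a ≤ b) :
    ∫ t in a..b, u' t = u b - u a :=
  intervalIntegral.integral_eq_sub_of_hasDerivAt_of_le hab hu.cont hu.hasDerivAt
    (ContinuousOn.intervalIntegrable (by rw [uIcc_of_le hab]; exact hu.cont'))

end

/-! ### The projection in time -/

theorem exists_derivative_eq (q : ℝ[X]) {n : ℕ} (hq : q.degree < n) :
    ∃ Q : ℝ[X], derivative Q = q ∧ Q.degree < (n + 1 : ℕ) := by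
  refine ⟨∑ i ∈ Finset.range n, C (q.coeff i / (i + 1)) * X ^ (i + 1), ?_, ?_⟩
  · have h0 : q = ∑ i ∈ Finset.range n, C (q.coeff i) * X ^ i := by
      by_cases hz : q = 0
      · simp [hz]
      · exact q.as_sum_range_C_mul_X_pow' ((natDegree_lt_iff_degree_lt hz).2 hq)
    conv_rhs => rw [h0]
    rw [derivative_sum]
    refine Finset.sum_congr rfl fun i _ => ?_
    have : (i + 1 : ℝ) ≠ 0 := by positivity
    rw [derivative_C_mul_X_pow]
    congr 2
    push_cast
    field_simp
  · refine (degree_sum_le _ _).trans_lt ?_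
    rw [Finset.sup_lt_iff (by exact_mod_cast WithBot.bot_lt_coe (n + 1))]
    intro i hi
    refine (degree_C_mul_X_pow_le _ _).trans_lt ?_
    exact_mod_cast Nat.succ_lt_succ (Finset.mem_range.1 hi)

/-- The properties that characterize `Π_N u` on `[a, b]`, for `N = m + 1`. -/
structure IsTimeProj {V : Type*} [NormedAddCommGroup V] [NormedSpace ℝ V] (m : ℕ) (a b : ℝ)
    (u u' p : ℝ → V) : Prop where
  mem : p ∈ timePoly (m + 1) (univ : Set V)
  left : p a = u a
  right : p b = u b
  orth : ∀ q : ℝ[X], q.degree < (m + 1 : ℕ) →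
    ∫ t in a..b, q.eval t • (u' t - deriv p t) = 0

section

variable {V : Type*} [NormedAddCommGroup V] [NormedSpace ℝ V] {a b : ℝ}

theorem hasDerivAt_interp (a b : ℝ) (u : ℝ → V) (t : ℝ) :
    HasDerivAt (interp a b u) ((b - a)⁻¹ • (u b - u a)) t := by
  have h1 : HasDerivAt (fun t : ℝ => (b - t) / (b - a)) (-1 / (b - a)) t :=
    ((hasDerivAt_id t).const_sub b).div_const _
  have h2 : HasDerivAt (fun t : ℝ => (t - a) / (b - a)) (1 / (b - a)) t :=
    ((hasDerivAt_id t).sub_const a).div_const _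
  have h := (h1.smul_const (u a)).add (h2.smul_const (u b))
  refine h.congr_deriv ?_
  rw [smul_sub, neg_div, neg_smul, one_div]
  abel

theorem interp_left (hab : a < b) (u : ℝ → V) : interp a b u a = u a := by
  have := (sub_pos.2 hab).ne'
  simp [interp, this]

theorem interp_right (hab : a < b) (u : ℝ → V) : interp a b u b = u b := by
  have := (sub_pos.2 hab).ne'
  simp [interp, this]

theorem interp_mem (a b : ℝ) (u : ℝ → V) (m : ℕ) :
    interp a b u ∈ timePoly (m + 1) (univ : Set V) := by
  have hdeg : ∀ c e : ℝ, (C c * X + C e : ℝ[X]).degree < (m + 1 + 1 : ℕ) := fun c e =>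
    degree_linear_le.trans_lt (by
      exact_mod_cast (Nat.succ_lt_succ (Nat.succ_pos m)))
  have := timePoly_add (Y := (⊤ : Submodule ℝ V)) (n := m + 1)
    (timePoly_eval_smul (hdeg (-(b - a)⁻¹) (b / (b - a))) (Submodule.mem_top (x := u a)))
    (timePoly_eval_smul (hdeg ((b - a)⁻¹) (-a / (b - a))) (Submodule.mem_top (x := u b)))
  simp only [Submodule.top_coe] at this
  convert this using 1
  funext t
  simp only [interp, Pi.add_apply, eval_add, eval_mul, eval_C, eval_X]
  congr 2 <;> ring

end

section

variable {V : Type*} [NormedAddCommGroup V] [NormedSpace ℝ V] [CompleteSpace V]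
  {a b : ℝ} {u u' : ℝ → V} {m : ℕ}

theorem integral_scaledLegendre_smul_sum (hab : a < b) (e : ℕ → V) {j : ℕ}
    (hj : j ∈ Finset.range (m + 1)) :
    ∫ t in a..b, (scaledLegendre a b j).eval t •
        ∑ k ∈ Finset.range (m + 1), (scaledLegendre a b k).eval t • e k =
      (∫ t in a..b, (scaledLegendre a b j).eval t ^ 2) • e j := by
  simp only [Finset.smul_sum, smul_smul]
  rw [intervalIntegral.integral_finsetSum fun k _ =>
    Continuous.intervalIntegrable (by fun_prop) _ _]
  simp only [intervalIntegral.integral_smul_const]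
  rw [Finset.sum_eq_single j]
  · simp only [pow_two]
  · intro k _ hk
    rw [integral_scaledLegendre_mul hab hk.symm, zero_smul]
  · exact fun h => absurd hj h

/-- The derivative of `p` is the `L²` projection of `u'` on polynomials of degree at most `m`: `g k`
are the Legendre coefficients of `u'`, and `p` is the primitive that vanishes at `a`. -/
theorem exists_orth_primitive (hab : a < b) (hu' : ContinuousOn u' (Icc a b)) (m : ℕ) :
    ∃ p ∈ timePoly (m + 1) (univ : Set V), p a = 0 ∧ ∀ q : ℝ[X], q.degree < (m + 1 : ℕ) →
      ∫ t in a..b, q.eval t • (u' t - deriv p t) = 0 := by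
  have hQ : ∀ k ∈ Finset.range (m + 1), ∃ Q : ℝ[X], derivative Q = scaledLegendre a b k ∧
      Q.degree < (m + 1 + 1 : ℕ) := fun k hk =>
    exists_derivative_eq _ (degree_scaledLegendre_lt a b (Finset.mem_range.1 hk))
  choose! Q hQd hQdeg using hQ
  set g : ℕ → V := fun k => (∫ t in a..b, (scaledLegendre a b k).eval t ^ 2)⁻¹ •
    ∫ t in a..b, (scaledLegendre a b k).eval t • u' t with hg
  set p : ℝ → V := fun t => ∑ k ∈ Finset.range (m + 1), ((Q k).eval t - (Q k).eval a) • g k with hp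
  have hderiv : ∀ t, HasDerivAt p
      (∑ k ∈ Finset.range (m + 1), (scaledLegendre a b k).eval t • g k) t := by
    intro t
    refine HasDerivAt.fun_sum fun k hk => HasDerivAt.smul_const ?_ _
    rw [← hQd k hk]
    exact ((Q k).hasDerivAt t).sub_const _
  have hu : IntervalIntegrable u' volume a b := by
    rw [← uIcc_of_le hab.le] at hu'; exact hu'.intervalIntegrable
  have hmul : ∀ q : ℝ[X], IntervalIntegrable (fun t => q.eval t • u' t) volume a b := fun q => by
    rw [← uIcc_of_le hab.le] at hu'
    exact (q.continuous.continuousOn.smul hu').intervalIntegrable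
  refine ⟨p, ?_, ?_, fun q hq => ?_⟩
  · have := timePoly_sum (Y := (⊤ : Submodule ℝ V)) (n := m + 1) (Finset.range (m + 1))
      (p := fun k t => (Q k - C ((Q k).eval a)).eval t • g k) fun k hk =>
        timePoly_eval_smul (by
          refine (degree_sub_le _ _).trans_lt (max_lt (hQdeg k hk) ?_)
          exact degree_C_le.trans_lt (by exact_mod_cast Nat.succ_pos _)) Submodule.mem_top
    simpa [hp] using this
  · simp [hp]
  · obtain ⟨c, hc⟩ := exists_scaledLegendre_expansion hab (m + 1) q hq
    have hd : ∀ t, deriv p t = ∑ k ∈ Finset.range (m + 1), (scaledLegendre a b k).eval t • g k :=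
      fun t => (hderiv t).deriv
    have hbasis : ∀ j ∈ Finset.range (m + 1),
        ∫ t in a..b, (scaledLegendre a b j).eval t • (u' t - deriv p t) = 0 := by
      intro j hj
      simp only [hd, smul_sub]
      rw [intervalIntegral.integral_sub (hmul _)
        (Continuous.intervalIntegrable (by fun_prop) _ _),
        integral_scaledLegendre_smul_sum hab g hj, hg, smul_inv_smul₀
          (integral_scaledLegendre_sq_pos hab j).ne', sub_self]
    simp only [hc, Finset.sum_smul, mul_smul]
    rw [intervalIntegral.integral_finsetSum]
    · refine Finset.sum_eq_zero fun k hk => ?_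
      rw [intervalIntegral.integral_smul, hbasis k hk, smul_zero]
    · intro k _
      simp only [hd, smul_sub]
      exact ((hmul _).smul (c k)).sub (Continuous.intervalIntegrable (by fun_prop) _ _)

theorem exists_isTimeProjZero (hab : a < b) (hu : C1On a b u u') (ha : u a = 0) (hb : u b = 0)
    (m : ℕ) : ∃ p, IsTimeProjZero (m + 1) a b u p := by
  obtain ⟨p, hp, hpa, horth⟩ := exists_orth_primitive hab hu.cont' m
  have hpC : C1On a b p (deriv p) := C1On.of_timePoly (Y := ⊤) (by simpa using hp)
  refine ⟨p, hp, hpa, ?_, fun v hv hva hvb => ?_⟩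
  -- The condition at `b` is automatic: orthogonality to constants says that `u` and `p` have the
  -- same increment over `[a, b]`.
  · have h1 := horth 1 (by rw [degree_one]; exact_mod_cast Nat.succ_pos m)
    simp only [eval_one, one_smul] at h1
    have h2 := (hu.sub hpC).integral_eq_sub hab.le
    simp only [Pi.sub_apply, h1, ha, hb, hpa] at h2
    simpa using h2.symm
  · rw [hu.integral_congr hab.le (fun t x => v.derivative.eval t • (x - deriv p t))]
    refine horth _ ?_
    by_cases h0 : derivative v = 0
    · rw [h0, degree_zero]; exact WithBot.bot_lt_coe _
    · rw [← natDegree_lt_iff_degree_lt h0]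
      have := natDegree_derivative_le v
      omega

theorem isTimeProj_timeProj (hab : a < b) (hu : C1On a b u u') (m : ℕ) :
    IsTimeProj m a b u u' (timeProj (m + 1) a b u) := by
  set I := interp a b u with hI
  set s := (b - a)⁻¹ • (u b - u a) with hs
  have hIC : C1On a b I (fun _ => s) :=
    C1On.of_hasDerivAt (hasDerivAt_interp a b u) continuous_const
  have hw := hu.sub hIC
  have hex := exists_isTimeProjZero hab hw (by simp [hI, interp_left hab])
    (by simp [hI, interp_right hab]) m
  have hz : IsTimeProjZero (m + 1) a b (u - I) (timeProjZero (m + 1) a b (u - I)) :=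
    Classical.epsilon_spec hex
  set p := timeProjZero (m + 1) a b (u - I) with hp
  have hP : timeProj (m + 1) a b u = I + p := rfl
  obtain ⟨hpm, hpa, hpb, horth⟩ := hz
  have hPm : I + p ∈ timePoly (m + 1) (univ : Set V) := by
    simpa using timePoly_add (Y := ⊤) (by simpa using interp_mem a b u m) (by simpa using hpm)
  have hpC : C1On a b p (deriv p) := C1On.of_timePoly (Y := ⊤) (by simpa using hpm)
  have hPC : C1On a b (I + p) (deriv (I + p)) := C1On.of_timePoly (Y := ⊤) (by simpa using hPm)
  have hdP : ∀ t, deriv (I + p) t = s + deriv p t := fun t =>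
    ((hasDerivAt_interp a b u t).add
      (timePoly_hasDerivAt (Y := ⊤) (by simpa using hpm) t)).deriv
  have hleft : (I + p) a = u a := by simp [hI, interp_left hab, hpa]
  have hright : (I + p) b = u b := by simp [hI, interp_right hab, hpb]
  rw [hP]
  refine ⟨hPm, hleft, hright, fun q hq => ?_⟩
  have hcont : ContinuousOn (fun t => u' t - deriv (I + p) t) (uIcc a b) := by
    rw [uIcc_of_le hab.le]; exact hu.cont'.sub hPC.cont'
  obtain ⟨Q, hQd, hQdeg⟩ := exists_derivative_eq q hq
  -- The definition only tests with `v.derivative` for `v` vanishing at both ends, that is, with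
  -- polynomials of mean zero. Subtracting from a primitive `Q` of `q` its linear interpolant gives
  -- such a `v`, with derivative `q - κ`; the constant `κ` is handled by the matching end values.
  set κ := (Q.eval b - Q.eval a) / (b - a) with hκ
  set v : ℝ[X] := Q - C (Q.eval a) - C κ * (X - C a) with hv
  have hvd : derivative v = q - C κ := by simp [hv, hQd]
  have hvdeg : v.natDegree ≤ m + 1 := by
    rw [natDegree_le_iff_degree_le]
    have hQle : Q.degree ≤ (m + 1 : ℕ) := by
      rw [degree_le_iff_coeff_zero]
      rw [degree_lt_iff_coeff_zero] at hQdeg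
      intro i hi
      exact hQdeg i (by exact_mod_cast hi)
    have hlin : (C κ * (X - C a) : ℝ[X]).degree ≤ (m + 1 : ℕ) := by
      rw [show (C κ * (X - C a) : ℝ[X]) = C κ * X + C (-(κ * a)) by simp; ring]
      exact degree_linear_le.trans (by exact_mod_cast (by omega : 1 ≤ m + 1))
    refine (degree_sub_le _ _).trans (max_le ((degree_sub_le _ _).trans (max_le hQle ?_)) hlin)
    exact degree_C_le.trans (by exact_mod_cast Nat.zero_le _)
  have h1 := horth v hvdeg (by simp [hv]) (by
    have := (sub_pos.2 hab).ne'
    simp [hv, hκ, this])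
  rw [hw.integral_congr hab.le (fun t x => v.derivative.eval t • (x - deriv p t)), hvd] at h1
  simp only [Pi.sub_apply] at h1
  have h2 : ∫ t in a..b, (u' t - deriv (I + p) t) = 0 := by
    have := (hu.sub hPC).integral_eq_sub hab.le
    simp only [Pi.sub_apply] at this hleft hright
    rw [this, hleft, hright, sub_self, sub_self, sub_zero]
  have h3 : ∀ t, q.eval t • (u' t - deriv (I + p) t) =
      (q - C κ).eval t • (u' t - s - deriv p t) + κ • (u' t - deriv (I + p) t) := by
    intro t
    rw [hdP]
    simp only [eval_sub, eval_C, sub_smul, smul_sub, smul_add]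
    abel
  have hc1 : ContinuousOn (fun t => (q - C κ).eval t • (u' t - s - deriv p t))
      (uIcc a b) := by
    rw [uIcc_of_le hab.le]
    exact (q - C κ).continuous.continuousOn.smul
      ((hu.cont'.sub continuousOn_const).sub hpC.cont')
  have hc2 : ContinuousOn (fun t => κ • (u' t - deriv (I + p) t)) (uIcc a b) := hcont.const_smul κ
  simp only [h3]
  rw [intervalIntegral.integral_add hc1.intervalIntegrable
    hc2.intervalIntegrable, h1, intervalIntegral.integral_smul, h2]
  simp

/-- The difference has a derivative of degree at most `m` that is orthogonal to every Legendre
polynomial up to `m`, hence zero; the values at `a` agree. -/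
theorem IsTimeProj.unique (hab : a < b) {p q : ℝ → V} (hu' : ContinuousOn u' (Icc a b))
    (hp : IsTimeProj m a b u u' p) (hq : IsTimeProj m a b u u' q) : p = q := by
  have hr : p - q ∈ timePoly (m + 1) ((⊤ : Submodule ℝ V) : Set V) :=
    timePoly_sub (by simpa using hp.mem) (by simpa using hq.mem)
  have hpd := timePoly_hasDerivAt (Y := (⊤ : Submodule ℝ V)) (by simpa using hp.mem)
  have hqd := timePoly_hasDerivAt (Y := (⊤ : Submodule ℝ V)) (by simpa using hq.mem)
  have hpc := timePoly_continuous
    (timePoly_deriv_mem (Y := (⊤ : Submodule ℝ V)) (by simpa using hp.mem))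
  have hqc := timePoly_continuous
    (timePoly_deriv_mem (Y := (⊤ : Submodule ℝ V)) (by simpa using hq.mem))
  have hd : ∀ t, deriv (p - q) t = deriv p t - deriv q t := fun t => ((hpd t).sub (hqd t)).deriv
  obtain ⟨e, he⟩ := timePoly_legendre_expansion hab (timePoly_deriv_mem hr)
  have he0 : ∀ j ∈ Finset.range (m + 1), e j = 0 := by
    intro j hj
    have hdeg := degree_scaledLegendre_lt a b (Finset.mem_range.1 hj)
    have h1 := hp.orth _ hdeg
    have h2 := hq.orth _ hdeg
    have hci : ∀ w : ℝ → V, Continuous w →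
        IntervalIntegrable (fun t => (scaledLegendre a b j).eval t • (u' t - w t)) volume a b := by
      intro w hw
      refine ContinuousOn.intervalIntegrable ?_
      rw [uIcc_of_le hab.le]
      exact (scaledLegendre a b j).continuous.continuousOn.smul (hu'.sub hw.continuousOn)
    have h3 : ∫ t in a..b, (scaledLegendre a b j).eval t • deriv (p - q) t = 0 := by
      have := intervalIntegral.integral_sub (hci _ hqc) (hci _ hpc)
      rw [h1, h2, sub_zero] at this
      rw [← this]
      refine intervalIntegral.integral_congr fun t _ => ?_
      simp only [hd, smul_sub]
      abel
    simp only [he] at h3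
    rw [integral_scaledLegendre_smul_sum hab e hj] at h3
    exact (smul_eq_zero.1 h3).resolve_left (integral_scaledLegendre_sq_pos hab j).ne'
  have hzero : ∀ t, deriv (p - q) t = 0 := fun t => by
    rw [he]
    exact Finset.sum_eq_zero fun k hk => by rw [he0 k hk, smul_zero]
  funext t
  have hconst := is_const_of_deriv_eq_zero
    (fun t => (timePoly_hasDerivAt hr t).differentiableAt) hzero t a
  simp only [Pi.sub_apply, hp.left, hq.left, sub_self] at hconst
  exact sub_eq_zero.1 hconst

/-- By uniqueness, since a continuous linear map passes through the integrals and end values that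
characterize the projection. It is applied to the elliptic projection to interchange `Π_N` and
`Π_M^0`. -/
theorem timeProj_map {Z : Type*} [NormedAddCommGroup Z] [NormedSpace ℝ Z] [CompleteSpace Z]
    (A : V →L[ℝ] Z) (hab : a < b) (hu : C1On a b u u') (m : ℕ) :
    timeProj (m + 1) a b (fun t => A (u t)) = fun t => A (timeProj (m + 1) a b u t) := by
  have h := isTimeProj_timeProj hab hu m
  have hd := timePoly_hasDerivAt (Y := (⊤ : Submodule ℝ V)) (by simpa using h.mem)
  have hdA : ∀ t, deriv (fun t => A (timeProj (m + 1) a b u t)) t =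
      A (deriv (timeProj (m + 1) a b u) t) := fun t =>
    (A.hasFDerivAt.comp_hasDerivAt t (hd t)).deriv
  refine (isTimeProj_timeProj hab (hu.map A) m).unique hab (hu.map A).cont'
    ⟨timePoly_map A.toLinearMap (fun _ _ => mem_univ _) h.mem, by simp [h.left], by simp [h.right],
      fun q hq => ?_⟩
  have hc : ContinuousOn (fun t => q.eval t • (u' t - deriv (timeProj (m + 1) a b u) t))
      (uIcc a b) := by
    rw [uIcc_of_le hab.le]
    exact q.continuous.continuousOn.smul (hu.cont'.sub (timePoly_continuous
      (timePoly_deriv_mem (Y := (⊤ : Submodule ℝ V)) (by simpa using h.mem))).continuousOn)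
  have := A.intervalIntegral_comp_comm (μ := volume) hc.intervalIntegrable
  rw [h.orth q hq, map_zero] at this
  rw [← this]
  refine intervalIntegral.integral_congr fun t _ => ?_
  simp [hdA]

end

/-! ### Integration by parts and uniqueness of the weak gradient in `H01` -/

section

variable {d : ℕ} {Ω : Set (EuclideanSpace ℝ (Fin d))}

instance : CompleteSpace (H01 Ω) :=
  (Submodule.isClosed_topologicalClosure _).completeSpace_coe

/-- The embedding `H¹₀(Ω) → L²(Ω)` as a continuous linear map. -/
noncomputable def toL2L : H01 Ω →L[ℝ] L2 Ω :=
  (WithLp.fstL 2 ℝ (L2 Ω) (L2Vec Ω)).comp (h01Submodule Ω).subtypeL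

/-- The weak gradient as a continuous linear map. -/
noncomputable def gradL : H01 Ω →L[ℝ] L2Vec Ω :=
  (WithLp.sndL 2 ℝ (L2 Ω) (L2Vec Ω)).comp (h01Submodule Ω).subtypeL

theorem toL2L_apply (w : H01 Ω) : toL2L w = toL2 w := rfl

theorem gradL_apply (w : H01 Ω) : gradL w = grad w := rfl

theorem toL2_add (v w : H01 Ω) : toL2 (v + w) = toL2 v + toL2 w := map_add toL2L v w
theorem toL2_sub (v w : H01 Ω) : toL2 (v - w) = toL2 v - toL2 w := map_sub toL2L v w
theorem toL2_smul (c : ℝ) (w : H01 Ω) : toL2 (c • w) = c • toL2 w := map_smul toL2L c w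
theorem toL2_zero : toL2 (0 : H01 Ω) = 0 := map_zero toL2L
theorem grad_add (v w : H01 Ω) : grad (v + w) = grad v + grad w := map_add gradL v w
theorem grad_sub (v w : H01 Ω) : grad (v - w) = grad v - grad w := map_sub gradL v w
theorem grad_smul (c : ℝ) (w : H01 Ω) : grad (c • w) = c • grad w := map_smul gradL c w
theorem grad_zero : grad (0 : H01 Ω) = 0 := map_zero gradL

theorem H01.ext_parts {v w : H01 Ω} (h1 : toL2 v = toL2 w) (h2 : grad v = grad w) : v = w :=
  Subtype.ext (WithLp.ofLp_injective 2 (Prod.ext h1 h2))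

/-- A continuous functional that vanishes on the test functions vanishes on `H¹₀(Ω)`. -/
theorem eq_zero_of_testPairs (Λ : L2Pair Ω →L[ℝ] ℝ) (h : ∀ z ∈ testPairs Ω, Λ z = 0)
    (w : H01 Ω) : Λ w = 0 := by
  have h1 : h01Submodule Ω ≤ LinearMap.ker (Λ : L2Pair Ω →ₗ[ℝ] ℝ) :=
    Submodule.topologicalClosure_minimal _ (Submodule.span_le.2 fun z hz => h z hz)
      Λ.isClosed_ker
  exact h1 w.2

theorem isFiniteMeasure_restrict (hΩb : Bornology.IsBounded Ω) :
    IsFiniteMeasure (volume.restrict Ω) :=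
  ⟨by simpa using hΩb.measure_lt_top⟩

theorem memLp_of_continuous (hΩo : IsOpen Ω) (hΩb : Bornology.IsBounded Ω) {G : Type*}
    [NormedAddCommGroup G] {F : EuclideanSpace ℝ (Fin d) → G} (hF : Continuous F) :
    MemLp F 2 (volume.restrict Ω) := by
  have := isFiniteMeasure_restrict hΩb
  obtain ⟨C, hC⟩ := hΩb.isCompact_closure.exists_bound_of_continuousOn hF.continuousOn
  exact MemLp.of_bound hF.aestronglyMeasurable C
    (ae_restrict_of_forall_mem hΩo.measurableSet fun x hx => hC x (subset_closure hx))

theorem inner_toLp {G : Type*} [NormedAddCommGroup G] [InnerProductSpace ℝ G]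
    {F : EuclideanSpace ℝ (Fin d) → G} (hF : MemLp F 2 (volume.restrict Ω))
    (z : Lp G 2 (volume.restrict Ω)) :
    inner ℝ (hF.toLp F) z = ∫ x in Ω, inner ℝ (F x) (z x) := by
  rw [L2.inner_def]
  refine integral_congr_ae ?_
  filter_upwards [hF.coeFn_toLp] with x hx
  rw [hx]

theorem continuous_gradient {φ : EuclideanSpace ℝ (Fin d) → ℝ} (hφ : ContDiff ℝ 1 φ) :
    Continuous (gradient φ) :=
  (InnerProductSpace.toDual ℝ _).symm.continuous.comp (hφ.continuous_fderiv one_ne_zero)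

theorem exists_testFunction (hΩo : IsOpen Ω) (hΩb : Bornology.IsBounded Ω)
    {φ : EuclideanSpace ℝ (Fin d) → ℝ} (hφ : ContDiff ℝ ∞ φ) (hc : HasCompactSupport φ)
    (hs : tsupport φ ⊆ Ω) :
    ∃ w : H01 Ω, toL2 w =ᵐ[volume.restrict Ω] φ ∧ grad w =ᵐ[volume.restrict Ω] gradient φ := by
  have h1 := memLp_of_continuous hΩo hΩb hφ.continuous
  have h2 := memLp_of_continuous hΩo hΩb (continuous_gradient (hφ.of_le (by exact_mod_cast le_top)))
  refine ⟨⟨WithLp.toLp 2 (h1.toLp φ, h2.toLp (gradient φ)),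
    Submodule.le_topologicalClosure _ (Submodule.subset_span
      ⟨φ, hφ, hc, hs, h1.coeFn_toLp, h2.coeFn_toLp⟩)⟩, h1.coeFn_toLp, h2.coeFn_toLp⟩

/-- Integration by parts on `Ω` against a smooth function that need not vanish at the boundary. -/
theorem integral_toL2_mul_fderiv (hΩo : IsOpen Ω) (hΩb : Bornology.IsBounded Ω) (w : H01 Ω)
    {ψ : EuclideanSpace ℝ (Fin d) → ℝ} (hψ : ContDiff ℝ 1 ψ) (v : EuclideanSpace ℝ (Fin d)) :
    ∫ x in Ω, fderiv ℝ ψ x v * toL2 w x = - ∫ x in Ω, ψ x * inner ℝ v (grad w x) := by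
  have hψd : Continuous fun x => fderiv ℝ ψ x v :=
    (hψ.continuous_fderiv one_ne_zero).clm_apply continuous_const
  have ha := memLp_of_continuous hΩo hΩb hψd
  have hb := memLp_of_continuous hΩo hΩb
    (show Continuous fun x => ψ x • v from hψ.continuous.smul continuous_const)
  -- The identity says that a continuous functional of the pair (function, gradient) vanishes, so it
  -- is enough to check it for test functions, where it is the classical formula on the whole space.
  set Λ : L2Pair Ω →L[ℝ] ℝ :=
    (innerSL ℝ (ha.toLp _)).comp (WithLp.fstL 2 ℝ (L2 Ω) (L2Vec Ω)) +
      (innerSL ℝ (hb.toLp _)).comp (WithLp.sndL 2 ℝ (L2 Ω) (L2Vec Ω)) with hΛ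
  have hΛz : ∀ z : L2Pair Ω, Λ z = (∫ x in Ω, fderiv ℝ ψ x v * z.fst x) +
      ∫ x in Ω, ψ x * inner ℝ v (z.snd x) := by
    intro z
    have : Λ z = inner ℝ (ha.toLp _) z.fst + inner ℝ (hb.toLp _) z.snd := rfl
    rw [this, inner_toLp, inner_toLp]
    simp only [real_inner_smul_left]
    congr 1
    refine integral_congr_ae (Filter.Eventually.of_forall fun x => ?_)
    simp [mul_comm]
  have h := eq_zero_of_testPairs Λ ?_ w
  · rw [hΛz] at h
    exact eq_neg_of_add_eq_zero_left h
  rintro z ⟨φ, hφ, hc, hs, hz1, hz2⟩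
  have hφ1 : ContDiff ℝ 1 φ := hφ.of_le (by exact_mod_cast le_top)
  have hφd : Continuous fun x => fderiv ℝ φ x v :=
    (hφ1.continuous_fderiv one_ne_zero).clm_apply continuous_const
  have h0 : ∀ x, x ∉ Ω → φ x = 0 := fun x hx =>
    image_eq_zero_of_notMem_tsupport fun hx' => hx (hs hx')
  have h0d : ∀ x, x ∉ Ω → fderiv ℝ φ x v = 0 := fun x hx => by
    have : x ∉ tsupport (fderiv ℝ φ) := fun hx' => hx (hs (tsupport_fderiv_subset ℝ hx'))
    rw [image_eq_zero_of_notMem_tsupport this]; rfl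
  have hcd : HasCompactSupport fun x => fderiv ℝ φ x v :=
    (hc.fderiv ℝ).comp_left (g := fun L : EuclideanSpace ℝ (Fin d) →L[ℝ] ℝ => L v) rfl
  rw [hΛz]
  have e1 : ∫ x in Ω, fderiv ℝ ψ x v * z.fst x = ∫ x, fderiv ℝ ψ x v * φ x := by
    rw [← setIntegral_eq_integral_of_forall_compl_eq_zero (s := Ω)
      (f := fun x => fderiv ℝ ψ x v * φ x) fun x hx => by
      rw [h0 x hx, mul_zero]]
    refine integral_congr_ae ?_
    filter_upwards [hz1] with x hx
    rw [hx]
  have e2 : ∫ x in Ω, ψ x * inner ℝ v (z.snd x) = ∫ x, ψ x * fderiv ℝ φ x v := by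
    rw [← setIntegral_eq_integral_of_forall_compl_eq_zero (s := Ω)
      (f := fun x => ψ x * fderiv ℝ φ x v) fun x hx => by
      rw [h0d x hx, mul_zero]]
    refine integral_congr_ae ?_
    filter_upwards [hz2] with x hx
    rw [hx, inner_gradient_right]
    rfl
  rw [e1, e2, integral_mul_fderiv_eq_neg_fderiv_mul_of_integrable]
  · ring
  · exact (hψd.mul hφ.continuous).integrable_of_hasCompactSupport hc.mul_left
  · exact (hψ.continuous.mul hφd).integrable_of_hasCompactSupport hcd.mul_left
  · exact (hψ.continuous.mul hφ.continuous).integrable_of_hasCompactSupport hc.mul_left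
  · exact fun x _ => (hψ.differentiable one_ne_zero).differentiableAt
  · exact fun x _ => (hφ1.differentiable one_ne_zero).differentiableAt

theorem Lp_eq_zero_of_integral_smul (hΩo : IsOpen Ω) {G : Type*} [NormedAddCommGroup G]
    [NormedSpace ℝ G] [CompleteSpace G] (g : Lp G 2 (volume.restrict Ω))
    (h : ∀ ψ : EuclideanSpace ℝ (Fin d) → ℝ, ContDiff ℝ ∞ ψ → HasCompactSupport ψ →
      tsupport ψ ⊆ Ω → ∫ x in Ω, ψ x • g x = 0) : g = 0 := by
  have hloc : LocallyIntegrableOn g Ω volume :=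
    locallyIntegrableOn_of_locallyIntegrable_restrict ((Lp.memLp g).locallyIntegrable (by norm_num))
  have h1 := hΩo.ae_eq_zero_of_integral_contDiff_smul_eq_zero hloc fun ψ hψ hc hs => by
    rw [← h ψ hψ hc hs, setIntegral_eq_integral_of_forall_compl_eq_zero fun x hx => ?_]
    rw [image_eq_zero_of_notMem_tsupport fun hx' => hx (hs hx'), zero_smul]
  rw [Lp.eq_zero_iff_ae_eq_zero]
  rw [Filter.EventuallyEq, ae_restrict_iff' hΩo.measurableSet]
  exact h1

/-- A function in `L²(Ω)` has at most one weak gradient. -/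
theorem grad_eq_zero_of_toL2_eq_zero (hΩo : IsOpen Ω) (hΩb : Bornology.IsBounded Ω) {w : H01 Ω}
    (hw : toL2 w = 0) : grad w = 0 := by
  refine Lp_eq_zero_of_integral_smul hΩo _ fun ψ hψ hc hs => ext_inner_left ℝ fun v => ?_
  have hψ1 : ContDiff ℝ 1 ψ := hψ.of_le (by exact_mod_cast le_top)
  have h1 := integral_toL2_mul_fderiv hΩo hΩb w hψ1 v
  have hint : Integrable (fun x => ψ x • grad w x) (volume.restrict Ω) := by
    have := (Lp.memLp (grad w)).smul (r := 1) (memLp_of_continuous hΩo hΩb hψ.continuous)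
    exact memLp_one_iff_integrable.1 this
  rw [inner_zero_right, ← integral_inner hint]
  simp only [real_inner_smul_right]
  rw [← neg_eq_zero, ← h1]
  rw [integral_eq_zero_of_ae]
  filter_upwards [Lp.eq_zero_iff_ae_eq_zero.1 hw] with x hx
  simp [hx]

/-- Since the weak gradient is unique, an element of `H01 Ω`, which is recorded as a pair, is
determined by its function alone. -/
theorem toL2_injective (hΩo : IsOpen Ω) (hΩb : Bornology.IsBounded Ω) :
    Function.Injective (toL2L : H01 Ω → L2 Ω) :=
  (injective_iff_map_eq_zero _).2 fun w hw => H01.ext_parts (by rw [toL2_zero]; exact hw)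
    (by rw [grad_zero]; exact grad_eq_zero_of_toL2_eq_zero hΩo hΩb hw)

end

section

variable {d : ℕ} {Ω : Set (EuclideanSpace ℝ (Fin d))}

/-! ### Polynomial functions on `ℝ^d` -/

/-- The function on `ℝ^d` given by a polynomial. -/
noncomputable def polyFun (p : MvPolynomial (Fin d) ℝ) (x : EuclideanSpace ℝ (Fin d)) : ℝ :=
  MvPolynomial.eval (fun i => x i) p

theorem hasFDerivAt_polyFun (p : MvPolynomial (Fin d) ℝ) (x : EuclideanSpace ℝ (Fin d)) :
    HasFDerivAt (polyFun p)
      (∑ i, polyFun (MvPolynomial.pderiv i p) x • EuclideanSpace.proj (𝕜 := ℝ) i) x := by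
  induction p using MvPolynomial.induction_on with
  | C a =>
    have : polyFun (MvPolynomial.C a : MvPolynomial (Fin d) ℝ) = fun _ => a := by
      funext y; simp [polyFun]
    rw [this]
    simpa [polyFun] using hasFDerivAt_const a x
  | add p q hp hq =>
    have : polyFun (p + q) = polyFun p + polyFun q := by funext y; simp [polyFun]
    rw [this]
    refine (hp.add hq).congr_fderiv ?_
    rw [← Finset.sum_add_distrib]
    refine Finset.sum_congr rfl fun i _ => ?_
    simp [polyFun, add_smul]
  | mul_X p j hp =>
    have : polyFun (p * MvPolynomial.X j) = fun y => polyFun p y * y j := by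
      funext y; simp [polyFun]
    rw [this]
    have hj : HasFDerivAt (fun y : EuclideanSpace ℝ (Fin d) => y j)
        (EuclideanSpace.proj (𝕜 := ℝ) j) x := (EuclideanSpace.proj (𝕜 := ℝ) j).hasFDerivAt
    refine (hp.mul hj).congr_fderiv ?_
    have hpd : ∀ i, polyFun (MvPolynomial.pderiv i (p * MvPolynomial.X j)) x =
        polyFun p x * (if i = j then 1 else 0) + x j * polyFun (MvPolynomial.pderiv i p) x := by
      intro i
      by_cases hij : i = j
      · subst hij
        simp [polyFun, mul_comm]
      · simp [polyFun, hij, MvPolynomial.pderiv_X_of_ne (Ne.symm hij)]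
    simp only [hpd]
    ext v
    simp [add_mul, Finset.sum_add_distrib, Finset.mul_sum, mul_assoc]

theorem contDiff_polyFun (p : MvPolynomial (Fin d) ℝ) : ContDiff ℝ ∞ (polyFun p) := by
  induction p using MvPolynomial.induction_on with
  | C a =>
    have : polyFun (MvPolynomial.C a : MvPolynomial (Fin d) ℝ) = fun _ => a := by
      funext y; simp [polyFun]
    rw [this]
    exact contDiff_const
  | add p q hp hq =>
    have : polyFun (p + q) = polyFun p + polyFun q := by funext y; simp [polyFun]
    rw [this]
    exact hp.add hq
  | mul_X p j hp =>
    have : polyFun (p * MvPolynomial.X j) = fun y => polyFun p y * y j := by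
      funext y; simp [polyFun]
    rw [this]
    exact hp.mul (EuclideanSpace.proj (𝕜 := ℝ) j).contDiff

theorem exists_pderiv_eq (i : Fin d) (p : MvPolynomial (Fin d) ℝ) :
    ∃ q, MvPolynomial.pderiv i q = p := by
  induction p using MvPolynomial.induction_on' with
  | monomial s a =>
    refine ⟨MvPolynomial.monomial (s + Finsupp.single i 1) (a / (s i + 1)), ?_⟩
    have : (s i + 1 : ℝ) ≠ 0 := by positivity
    rw [MvPolynomial.pderiv_monomial]
    simp [this]
  | add p q hp hq =>
    obtain ⟨P, rfl⟩ := hp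
    obtain ⟨Q, rfl⟩ := hq
    exact ⟨P + Q, map_add _ _ _⟩

/-- A polynomial function in `H¹₀(Ω)` with vanishing gradient vanishes. -/
theorem eq_zero_of_grad_eq_zero (hd : 0 < d) (hΩo : IsOpen Ω) (hΩb : Bornology.IsBounded Ω)
    {w : H01 Ω} {p : MvPolynomial (Fin d) ℝ} (hp : toL2 w =ᵐ[volume.restrict Ω] polyFun p)
    (hw : grad w = 0) : w = 0 := by
  set i : Fin d := ⟨0, hd⟩
  -- With `q` a primitive of `p` in one coordinate, integration by parts turns the squared `L²` norm
  -- of `w` into an integral against its gradient. Having such a coordinate requires `0 < d`.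
  obtain ⟨q, hq⟩ := exists_pderiv_eq i p
  have h := integral_toL2_mul_fderiv hΩo hΩb w
    ((contDiff_polyFun q).of_le (by exact_mod_cast le_top)) (EuclideanSpace.single i 1)
  have h1 : ∀ x, fderiv ℝ (polyFun q) x (EuclideanSpace.single i 1) = polyFun p x := by
    intro x
    rw [(hasFDerivAt_polyFun q x).fderiv, ← hq]
    simp
  have h2 : ∫ x in Ω, polyFun q x * inner ℝ (EuclideanSpace.single i (1 : ℝ)) (grad w x) = 0 := by
    refine integral_eq_zero_of_ae ?_
    filter_upwards [Lp.eq_zero_iff_ae_eq_zero.1 hw] with x hx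
    simp [hx]
  have h3 : inner ℝ (toL2 w) (toL2 w) = (0 : ℝ) := by
    rw [L2.inner_def, ← neg_zero, ← h2, ← h]
    refine integral_congr_ae ?_
    filter_upwards [hp] with x hx
    rw [h1, hx]
    simp [pow_two]
  refine toL2_injective hΩo hΩb ?_
  rw [map_zero]
  exact inner_self_eq_zero.1 h3

/-! ### The space `P_M^0(Ω)` -/

/-- `P_M^0(Ω)` as a subspace of `H¹₀(Ω)`. -/
noncomputable def polySub (Ω : Set (EuclideanSpace ℝ (Fin d))) (M : ℕ) : Submodule ℝ (H01 Ω) where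
  carrier := polySpace Ω M
  zero_mem' := by
    refine ⟨0, by simp, by simp, ?_⟩
    rw [toL2_zero]
    filter_upwards [Lp.coeFn_zero ℝ 2 (volume.restrict Ω)] with x hx
    exact hx.trans (by simp)
  add_mem' := by
    rintro v w ⟨p, hp1, hp2, hp3⟩ ⟨q, hq1, hq2, hq3⟩
    refine ⟨p + q, (MvPolynomial.totalDegree_add _ _).trans (max_le hp1 hq1), fun x hx => by
      rw [map_add, hp2 x hx, hq2 x hx, add_zero], ?_⟩
    rw [toL2_add]
    filter_upwards [Lp.coeFn_add (toL2 v) (toL2 w), hp3, hq3] with x hx h1 h2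
    exact hx.trans (by simp [h1, h2])
  smul_mem' := by
    rintro c w ⟨p, hp1, hp2, hp3⟩
    refine ⟨c • p, (MvPolynomial.totalDegree_smul_le _ _).trans hp1, fun x hx => by
      rw [MvPolynomial.smul_eval, hp2 x hx, mul_zero], ?_⟩
    rw [toL2_smul]
    filter_upwards [Lp.coeFn_smul c (toL2 w), hp3] with x hx h1
    exact hx.trans (by simp [h1])

/-- Restriction to `L²` is injective and lands in the image of the polynomials of total degree at
most `M`. -/
theorem finiteDimensional_polySub (hΩo : IsOpen Ω) (hΩb : Bornology.IsBounded Ω) (M : ℕ) :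
    FiniteDimensional ℝ (polySub Ω M) := by
  have hp : ∀ p : MvPolynomial (Fin d) ℝ, MemLp (polyFun p) 2 (volume.restrict Ω) := fun p =>
    memLp_of_continuous hΩo hΩb (contDiff_polyFun p).continuous
  set Φ : MvPolynomial.restrictTotalDegree (Fin d) ℝ M →ₗ[ℝ] L2 Ω :=
    { toFun := fun p => (hp p).toLp _
      map_add' := fun p q => by
        rw [← MemLp.toLp_add]
        refine MemLp.toLp_congr _ _ (Filter.Eventually.of_forall fun x => ?_)
        simp [polyFun]
      map_smul' := fun c p => by
        rw [RingHom.id_apply, ← MemLp.toLp_const_smul]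
        refine MemLp.toLp_congr _ _ (Filter.Eventually.of_forall fun x => ?_)
        simp [polyFun] } with hΦ
  have hmem : ∀ w : polySub Ω M, toL2L (w : H01 Ω) ∈ LinearMap.range Φ := by
    rintro ⟨w, p, hp1, hp2, hp3⟩
    refine ⟨⟨p, (MvPolynomial.mem_restrictTotalDegree _ _ _).2 hp1⟩, ?_⟩
    refine Lp.ext ?_
    filter_upwards [(hp p).coeFn_toLp, hp3] with x hx1 hx2
    exact hx1.trans hx2.symm
  set A : polySub Ω M →ₗ[ℝ] LinearMap.range Φ :=
    LinearMap.codRestrict _ ((toL2L : H01 Ω →L[ℝ] L2 Ω).toLinearMap ∘ₗ (polySub Ω M).subtype) hmem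
  refine FiniteDimensional.of_injective A fun v w hvw => Subtype.ext ?_
  exact toL2_injective hΩo hΩb (congrArg Subtype.val hvw)

/-! ### The elliptic projection -/

/-- The gradient `G` is injective on the finite-dimensional polynomial space, so the projection is
`G⁻¹` after the orthogonal projection of `grad w` on the range of `G`. Continuity follows from
finite dimension, without a Poincaré inequality. The same injectivity gives uniqueness, which
identifies the chosen `spaceProj` with this map. -/
theorem exists_spaceProj_clm (hd : 0 < d) (hΩo : IsOpen Ω) (hΩb : Bornology.IsBounded Ω) (M : ℕ) :
    ∃ A : H01 Ω →L[ℝ] H01 Ω, ∀ w, IsSpaceProj M w (A w) ∧ spaceProj M w = A w := by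
  have := finiteDimensional_polySub hΩo hΩb M
  have hzero : ∀ p ∈ polySpace Ω M, grad p = 0 → p = 0 := by
    rintro p ⟨q, -, -, hq⟩ h
    exact eq_zero_of_grad_eq_zero hd hΩo hΩb hq h
  set G : polySub Ω M →ₗ[ℝ] L2Vec Ω :=
    (gradL : H01 Ω →L[ℝ] L2Vec Ω).toLinearMap ∘ₗ (polySub Ω M).subtype with hG
  have hGinj : Function.Injective G := (injective_iff_map_eq_zero _).2 fun p hp =>
    Subtype.ext (hzero p p.2 hp)
  set R := LinearMap.range G with hR
  set e : polySub Ω M ≃ₗ[ℝ] R := LinearEquiv.ofInjective G hGinj with he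
  set A : H01 Ω →L[ℝ] H01 Ω := (polySub Ω M).subtypeL.comp
    ((e.symm.toLinearMap.toContinuousLinearMap).comp
      (R.orthogonalProjectionOnto.comp gradL)) with hA
  have hgrad : ∀ w, grad (A w) = R.orthogonalProjectionOnto (grad w) := by
    intro w
    have h1 : G (e.symm (R.orthogonalProjectionOnto (grad w))) =
        (e (e.symm (R.orthogonalProjectionOnto (grad w))) : L2Vec Ω) :=
      (LinearEquiv.ofInjective_apply G _).symm
    rw [LinearEquiv.apply_symm_apply] at h1
    exact h1
  have hproj : ∀ w, IsSpaceProj M w (A w) := by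
    intro w
    refine ⟨(e.symm (R.orthogonalProjectionOnto (grad w))).2, fun q hq => ?_⟩
    rw [grad_sub, hgrad, ← neg_sub, inner_neg_left, neg_eq_zero]
    exact R.starProjection_inner_eq_zero (grad w) _ ⟨⟨q, hq⟩, rfl⟩
  refine ⟨A, fun w => ⟨hproj w, ?_⟩⟩
  have hs : IsSpaceProj M w (spaceProj M w) := Classical.epsilon_spec ⟨_, hproj w⟩
  have hmem : spaceProj M w - A w ∈ polySpace Ω M :=
    (polySub Ω M).sub_mem hs.1 (hproj w).1
  refine sub_eq_zero.1 (hzero _ hmem (inner_self_eq_zero (𝕜 := ℝ).1 ?_))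
  have h1 := hs.2 _ hmem
  have h2 := (hproj w).2 _ hmem
  have h3 : grad (spaceProj M w - A w) = grad (spaceProj M w - w) - grad (A w - w) := by
    simp only [grad_sub]; abel
  have h4 := inner_sub_left (𝕜 := ℝ) (grad (spaceProj M w - w)) (grad (A w - w))
    (grad (spaceProj M w - A w))
  rwa [← h3, h1, h2, sub_zero] at h4

/-! ### The Laplacian of a polynomial -/

theorem isLaplacian_unique (hΩo : IsOpen Ω) (hΩb : Bornology.IsBounded Ω) {w : H01 Ω}
    {g g' : L2 Ω} (h : IsLaplacian w g) (h' : IsLaplacian w g') : g = g' := by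
  refine sub_eq_zero.1 (Lp_eq_zero_of_integral_smul hΩo _ fun ψ hψ hc hs => ?_)
  obtain ⟨φ, hφ, -⟩ := exists_testFunction hΩo hΩb hψ hc hs
  have h1 : inner ℝ (g - g') (toL2 φ) = (0 : ℝ) := by
    rw [inner_sub_left, h φ, h' φ, sub_self]
  rw [L2.inner_def] at h1
  rw [← h1]
  refine integral_congr_ae ?_
  filter_upwards [hφ] with x hx
  simp [hx]

/-- The Laplacian is the pointwise one, `P`. By density only test functions `φ` need checking, so
the behaviour of `w` at the boundary does not enter. -/
theorem exists_isLaplacian (hΩo : IsOpen Ω) (hΩb : Bornology.IsBounded Ω) {w : H01 Ω}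
    {p : MvPolynomial (Fin d) ℝ} (hp : toL2 w =ᵐ[volume.restrict Ω] polyFun p) :
    ∃ g, IsLaplacian w g := by
  set δ := fun (i : Fin d) (q : MvPolynomial (Fin d) ℝ) => MvPolynomial.pderiv i q with hδ
  set P : MvPolynomial (Fin d) ℝ := ∑ i, δ i (δ i p) with hP
  have hPL := memLp_of_continuous hΩo hΩb (contDiff_polyFun P).continuous
  have hpart : ∀ (q : MvPolynomial (Fin d) ℝ) (i : Fin d) (x : EuclideanSpace ℝ (Fin d)),
      fderiv ℝ (polyFun q) x (EuclideanSpace.single i 1) = polyFun (δ i q) x := by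
    intro q i x
    rw [(hasFDerivAt_polyFun q x).fderiv]
    simp [hδ]
  have hC1 : ∀ q : MvPolynomial (Fin d) ℝ, ContDiff ℝ 1 (polyFun q) := fun q =>
    (contDiff_polyFun q).of_le (by exact_mod_cast le_top)
  refine ⟨hPL.toLp _, fun φ => ?_⟩
  set Λ : L2Pair Ω →L[ℝ] ℝ :=
    (innerSL ℝ (hPL.toLp _)).comp (WithLp.fstL 2 ℝ (L2 Ω) (L2Vec Ω)) +
      (innerSL ℝ (grad w)).comp (WithLp.sndL 2 ℝ (L2 Ω) (L2Vec Ω)) with hΛ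
  have hΛz : ∀ z : L2Pair Ω, Λ z = inner ℝ (hPL.toLp _) z.fst + inner ℝ (grad w) z.snd :=
    fun z => rfl
  suffices h : Λ φ = 0 by
    rw [hΛz] at h
    exact eq_neg_of_add_eq_zero_left h
  refine eq_zero_of_testPairs Λ ?_ φ
  rintro z ⟨φ, hφ, hc, hs, hz1, hz2⟩
  have hsd : ∀ i : Fin d, ContDiff ℝ ∞ fun x => fderiv ℝ φ x (EuclideanSpace.single i 1) :=
    fun i => (hφ.fderiv_right (m := ∞) (by exact_mod_cast le_rfl)).clm_apply contDiff_const
  have hcd : ∀ i : Fin d, HasCompactSupport fun x => fderiv ℝ φ x (EuclideanSpace.single i 1) :=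
    fun i => (hc.fderiv ℝ).comp_left
      (g := fun L : EuclideanSpace ℝ (Fin d) →L[ℝ] ℝ => L (EuclideanSpace.single i 1)) rfl
  have hssd : ∀ i : Fin d, tsupport (fun x => fderiv ℝ φ x (EuclideanSpace.single i 1)) ⊆ Ω :=
    fun i => (closure_mono fun x hx => by
      rw [Function.mem_support] at hx ⊢
      intro h0
      exact hx (by rw [h0]; rfl)).trans ((tsupport_fderiv_subset ℝ (f := φ)).trans hs)
  obtain ⟨Φ, hΦ1, hΦ2⟩ := exists_testFunction hΩo hΩb hφ hc hs
  -- The weak gradient of `w` is not yet known to be that of `p`. So the derivative is moved from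
  -- `w` to `∂ᵢφ`, `w` is replaced by `p`, and two further integrations by parts, against `Ψ = ∂ᵢφ`
  -- and `Φ = φ` in `H01 Ω`, move both derivatives to `p`.
  have key : ∀ i : Fin d,
      ∫ x in Ω, fderiv ℝ φ x (EuclideanSpace.single i 1) *
          inner ℝ (EuclideanSpace.single i (1 : ℝ)) (grad w x) =
        - ∫ x in Ω, polyFun (δ i (δ i p)) x * φ x := by
    intro i
    set D := fun x => fderiv ℝ φ x (EuclideanSpace.single i 1) with hD
    obtain ⟨Ψ, hΨ1, hΨ2⟩ := exists_testFunction hΩo hΩb (hsd i) (hcd i) (hssd i)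
    have h1 := integral_toL2_mul_fderiv hΩo hΩb w ((hsd i).of_le (by exact_mod_cast le_top))
      (EuclideanSpace.single i 1)
    have h2 := integral_toL2_mul_fderiv hΩo hΩb Ψ (hC1 p) (EuclideanSpace.single i 1)
    have h3 := integral_toL2_mul_fderiv hΩo hΩb Φ (hC1 (δ i p)) (EuclideanSpace.single i 1)
    simp only [hpart] at h2 h3
    have e1 : ∫ x in Ω, fderiv ℝ D x (EuclideanSpace.single i 1) * toL2 w x =
        ∫ x in Ω, polyFun p x * inner ℝ (EuclideanSpace.single i (1 : ℝ)) (grad Ψ x) := by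
      refine integral_congr_ae ?_
      filter_upwards [hp, hΨ2] with x hx1 hx2
      rw [hx1, hx2, inner_gradient_right, mul_comm]
      rfl
    have e2 : ∫ x in Ω, polyFun (δ i p) x * toL2 Ψ x = ∫ x in Ω, polyFun (δ i p) x *
        inner ℝ (EuclideanSpace.single i (1 : ℝ)) (grad Φ x) := by
      refine integral_congr_ae ?_
      filter_upwards [hΨ1, hΦ2] with x hx1 hx2
      rw [hx1, hx2, inner_gradient_right]
      rfl
    have e3 : ∫ x in Ω, polyFun (δ i (δ i p)) x * toL2 Φ x =
        ∫ x in Ω, polyFun (δ i (δ i p)) x * φ x := by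
      refine integral_congr_ae ?_
      filter_upwards [hΦ1] with x hx1
      rw [hx1]
    linarith
  have hφ1 : ContDiff ℝ 1 φ := hφ.of_le (by exact_mod_cast le_top)
  have hint1 : ∀ i : Fin d, Integrable (fun x => fderiv ℝ φ x (EuclideanSpace.single i 1) *
      inner ℝ (EuclideanSpace.single i (1 : ℝ)) (grad w x)) (volume.restrict Ω) := fun i =>
    (memLp_of_continuous hΩo hΩb (hsd i).continuous).integrable_mul
      ((innerSL ℝ (EuclideanSpace.single i (1 : ℝ))).comp_memLp' (Lp.memLp (grad w)))
  have hint2 : ∀ i : Fin d, Integrable (fun x => polyFun (δ i (δ i p)) x * φ x)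
      (volume.restrict Ω) := fun i =>
    (memLp_of_continuous hΩo hΩb (contDiff_polyFun _).continuous).integrable_mul
      (memLp_of_continuous hΩo hΩb hφ.continuous)
  have e4 : inner ℝ (grad w) z.snd = ∑ i, ∫ x in Ω,
      fderiv ℝ φ x (EuclideanSpace.single i 1) *
        inner ℝ (EuclideanSpace.single i (1 : ℝ)) (grad w x) := by
    rw [L2.inner_def, ← integral_finsetSum _ fun i _ => hint1 i]
    refine integral_congr_ae ?_
    filter_upwards [hz2] with x hx
    rw [hx, ← (EuclideanSpace.basisFun (Fin d) ℝ).sum_inner_mul_inner]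
    refine Finset.sum_congr rfl fun i _ => ?_
    rw [EuclideanSpace.basisFun_apply, inner_gradient_right, mul_comm, real_inner_comm]
    rfl
  have e5 : inner ℝ (hPL.toLp _) z.fst = ∑ i, ∫ x in Ω, polyFun (δ i (δ i p)) x * φ x := by
    rw [inner_toLp, ← integral_finsetSum _ fun i _ => hint2 i]
    refine integral_congr_ae ?_
    filter_upwards [hz1] with x hx
    rw [hx, ← Finset.sum_mul]
    simp [hP, polyFun, mul_comm]
  rw [hΛz, e4, e5, ← Finset.sum_add_distrib]
  exact Finset.sum_eq_zero fun i _ => by rw [key i]; ring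

/-- Linearity comes from uniqueness and continuity from finite dimension. It makes the Laplacian of
the time projection error continuous in time, hence integrable. -/
theorem exists_laplacian_clm (hΩo : IsOpen Ω) (hΩb : Bornology.IsBounded Ω) (M : ℕ) :
    ∃ A : polySub Ω M →L[ℝ] L2 Ω, ∀ w : polySub Ω M,
      IsLaplacian (w : H01 Ω) (A w) ∧ laplacian (w : H01 Ω) = A w := by
  have := finiteDimensional_polySub hΩo hΩb M
  have hlap : ∀ w : polySub Ω M, IsLaplacian (w : H01 Ω) (laplacian (w : H01 Ω)) := by
    rintro ⟨w, p, -, -, hp⟩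
    exact Classical.epsilon_spec (exists_isLaplacian hΩo hΩb hp)
  set A : polySub Ω M →ₗ[ℝ] L2 Ω :=
    { toFun := fun w => laplacian (w : H01 Ω)
      map_add' := fun v w => isLaplacian_unique hΩo hΩb (hlap (v + w)) fun φ => by
        rw [Submodule.coe_add, grad_add, inner_add_left, inner_add_left, hlap v φ, hlap w φ]
        ring
      map_smul' := fun c w => isLaplacian_unique hΩo hΩb (hlap (c • w)) fun φ => by
        rw [RingHom.id_apply, Submodule.coe_smul, grad_smul, real_inner_smul_left,
          real_inner_smul_left, hlap w φ]
        ring } with hA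
  exact ⟨A.toContinuousLinearMap, fun w => ⟨hlap w, rfl⟩⟩

end

/-! ### The nonlinear term -/

section

variable {d : ℕ} {Ω : Set (EuclideanSpace ℝ (Fin d))}

theorem exists_nemytskii (hΩo : IsOpen Ω) (hΩb : Bornology.IsBounded Ω) {g : ℝ → ℝ} {L : NNReal}
    (hg : LipschitzWith L g) :
    ∃ G : L2 Ω → L2 Ω, LipschitzWith L G ∧ ∀ v, G v =ᵐ[volume.restrict Ω] fun x => g (v x) := by
  -- Composition preserves `L²` when the function vanishes at zero; the constant `g 0` is added
  -- back, as it lies in `L²` of a bounded set.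
  set g₀ : ℝ → ℝ := fun y => g y - g 0 with hg₀
  have hL₀ : LipschitzWith L g₀ := LipschitzWith.of_dist_le_mul fun x y => by
    have := hg.dist_le_mul x y
    simpa [hg₀, Real.dist_eq] using this
  have h0 : g₀ 0 = 0 := sub_self _
  have hc : MemLp (fun _ : EuclideanSpace ℝ (Fin d) => g 0) 2 (volume.restrict Ω) :=
    memLp_of_continuous hΩo hΩb continuous_const
  refine ⟨fun v => hL₀.compLp h0 v + hc.toLp _, ?_, fun v => ?_⟩
  · refine LipschitzWith.of_dist_le_mul fun v w => ?_
    rw [dist_add_right]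
    exact (hL₀.lipschitzWith_compLp h0).dist_le_mul v w
  · filter_upwards [Lp.coeFn_add (hL₀.compLp h0 v) (hc.toLp _), hL₀.coeFn_compLp h0 v,
      hc.coeFn_toLp] with x h1 h2 h3
    rw [h1, Pi.add_apply, h2, h3]
    simp [hg₀]

theorem nonlinPair_eq_inner {g : ℝ → ℝ} {G : L2 Ω → L2 Ω}
    (hG : ∀ v, G v =ᵐ[volume.restrict Ω] fun x => g (v x)) (w v : H01 Ω) :
    nonlinPair g w v = inner ℝ (G (toL2 w)) (toL2 v) := by
  rw [nonlinPair, L2.inner_def]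
  refine integral_congr_ae ?_
  filter_upwards [hG (toL2 w)] with x hx
  rw [hx]
  simp [mul_comm]

theorem nonlinPair_eq_inner_add {f : ℝ → ℝ} {S : ℝ} {G : L2 Ω → L2 Ω}
    (hG : ∀ v, G v =ᵐ[volume.restrict Ω] fun x => f (v x) - S * v x) (w v : H01 Ω) :
    nonlinPair f w v = inner ℝ (G (toL2 w)) (toL2 v) + S * inner ℝ (toL2 w) (toL2 v) := by
  rw [nonlinPair, ← real_inner_smul_left, ← inner_add_left, L2.inner_def]
  refine integral_congr_ae ?_
  filter_upwards [hG (toL2 w), Lp.coeFn_smul S (toL2 w),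
    Lp.coeFn_add (G (toL2 w)) (S • toL2 w)] with x h1 h2 h3
  rw [h3, Pi.add_apply, h1, h2]
  simp [mul_comm]

end

theorem lipschitzWith_sub_mul {f : ℝ → ℝ} (hf : Differentiable ℝ f) {L S : ℝ} (hL : 0 ≤ L)
    (hfL : ∀ y, |deriv f y - S| ≤ L) : LipschitzWith ⟨L, hL⟩ fun y => f y - S * y := by
  have hd : ∀ y, HasDerivAt (fun y => f y - S * y) (deriv f y - S) y := fun y =>
    ((hf y).hasDerivAt.sub ((hasDerivAt_id y).const_mul S)).congr_deriv (by simp)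
  refine lipschitzWith_of_nnnorm_deriv_le (fun y => (hd y).differentiableAt) fun y => ?_
  rw [(hd y).deriv]
  exact hfL y

/-! ### Time derivatives -/

section

variable {V : Type*} [NormedAddCommGroup V] [NormedSpace ℝ V] {a b : ℝ}
  {u u' v' : ℝ → V}

theorem C1On.hasTimeDeriv [CompleteSpace V] (hu : C1On a b u u') : HasTimeDeriv a b u u' := by
  obtain ⟨C, hC⟩ := isCompact_Icc.exists_bound_of_continuousOn hu.cont'
  have : IsFiniteMeasure (volume.restrict (Icc a b)) := ⟨by simp⟩
  refine ⟨MemLp.of_bound (hu.cont'.aestronglyMeasurable measurableSet_Icc) C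
    (ae_restrict_of_forall_mem measurableSet_Icc hC), fun t ht => ?_⟩
  rw [(hu.mono le_rfl ht.2).integral_eq_sub ht.1]
  abel

/-- `IsWeakSolution` supplies a time derivative of its own. By Lebesgue differentiation it agrees
almost everywhere with the classical one. -/
theorem HasTimeDeriv.ae_eq [CompleteSpace V] (h : HasTimeDeriv a b u u') (hu : C1On a b u v')
    (hab : a ≤ b) :
    ∀ᵐ t, t ∈ Ioc a b → u' t = v' t := by
  have : IsFiniteMeasure (volume.restrict (Icc a b)) := ⟨by simp⟩
  have hint : IntervalIntegrable u' volume a b := by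
    rw [intervalIntegrable_iff_integrableOn_Icc_of_le hab]
    exact h.1.integrable (by norm_num)
  have hne : ∀ᵐ t : ℝ, t ≠ b := by simp [ae_iff, measure_singleton]
  filter_upwards [hint.ae_hasDerivAt_integral, hne] with t ht htb hmem
  have htI : t ∈ Ioo a b := ⟨hmem.1, lt_of_le_of_ne hmem.2 htb⟩
  have h1 := (ht (by rw [uIcc_of_le hab]; exact Ioc_subset_Icc_self hmem) a left_mem_uIcc).const_add
    (u a)
  have h2 : u =ᶠ[nhds t] fun x => u a + ∫ s in a..x, u' s := by
    filter_upwards [Icc_mem_nhds htI.1 htI.2] with x hx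
    exact h.2 x hx
  exact (h1.congr_of_eventuallyEq h2).unique (hu.hasDerivAt t htI)

theorem C1On.of_contDiffOn {T : ℝ} (hT : 0 < T) {N : ℕ} (hu : ContDiffOn ℝ (N + 1) u (Icc 0 T)) :
    C1On 0 T u (derivWithin u (Icc 0 T)) := by
  have h1 : (1 : WithTop ℕ∞) ≤ N + 1 := by exact_mod_cast Nat.succ_le_succ (Nat.zero_le N)
  refine ⟨fun t ht => ?_, hu.continuousOn,
    hu.continuousOn_derivWithin (uniqueDiffOn_Icc hT) h1⟩
  exact ((hu.differentiableOn (by positivity)) t (Ioo_subset_Icc_self ht)).hasDerivWithinAt.hasDerivAt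
    (Icc_mem_nhds ht.1 ht.2)

theorem taylorWithinEval_mem_timePoly (f : ℝ → V) (n : ℕ) (s : Set ℝ) (x₀ : ℝ) :
    (fun t => taylorWithinEval f n s x₀ t) ∈ timePoly n (univ : Set V) := by
  have h := timePoly_sum (Y := (⊤ : Submodule ℝ V)) (n := n) (Finset.range (n + 1))
    (p := fun k t => ((C ((k.factorial : ℝ)⁻¹) * (X - C x₀) ^ k : ℝ[X]).eval t) •
      iteratedDerivWithin k f s x₀) fun k hk => timePoly_eval_smul (by
        refine degree_le_natDegree.trans_lt ?_
        have h1 : (C ((k.factorial : ℝ)⁻¹) * (X - C x₀) ^ k : ℝ[X]).natDegree ≤ k := by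
          refine (natDegree_C_mul_le _ _).trans (natDegree_pow_le.trans ?_)
          rw [natDegree_X_sub_C, mul_one]
        exact_mod_cast h1.trans_lt (Finset.mem_range.1 hk)) Submodule.mem_top
  simp only [Submodule.top_coe] at h
  convert h using 1
  funext t
  rw [taylor_within_apply]
  simp

end

/-! ### Integral inequalities in time -/

section

variable {H : Type*} [NormedAddCommGroup H] [InnerProductSpace ℝ H] {a b : ℝ}

theorem norm_integral_sq_le [CompleteSpace H] (hab : a < b) {F : ℝ → H}
    (hF : ContinuousOn F (Icc a b)) :
    ‖∫ t in a..b, F t‖ ^ 2 ≤ (b - a) * ∫ t in a..b, ‖F t‖ ^ 2 := by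
  have hpos : 0 < b - a := sub_pos.2 hab
  rw [← uIcc_of_le hab.le] at hF
  set y := ∫ t in a..b, F t with hy
  have hi1 : IntervalIntegrable (fun t => (b - a) * ‖F t‖ ^ 2) volume a b :=
    (continuousOn_const.mul (hF.norm.pow 2)).intervalIntegrable
  have hi2 : IntervalIntegrable (fun t => 2 * inner ℝ y (F t)) volume a b :=
    (continuousOn_const.mul (continuousOn_const.inner hF)).intervalIntegrable
  have hi3 : IntervalIntegrable (fun _ => (b - a)⁻¹ * ‖y‖ ^ 2) volume a b := intervalIntegrable_const
  have hin : ∫ t in a..b, inner ℝ y (F t) = ‖y‖ ^ 2 := by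
    have := (innerSL ℝ y).intervalIntegral_comp_comm (μ := volume) hF.intervalIntegrable
    simp only [innerSL_apply_apply] at this
    rw [this, ← hy, real_inner_self_eq_norm_sq]
  -- Cauchy-Schwarz: the integrand is the square of `(b - a) • F t - y`, divided by `b - a`.
  have h0 : 0 ≤ ∫ t in a..b, ((b - a) * ‖F t‖ ^ 2 - 2 * inner ℝ y (F t) + (b - a)⁻¹ * ‖y‖ ^ 2) := by
    refine intervalIntegral.integral_nonneg hab.le fun t _ => ?_
    have h1 : (b - a) * ‖F t‖ ^ 2 - 2 * inner ℝ y (F t) + (b - a)⁻¹ * ‖y‖ ^ 2 =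
        (b - a)⁻¹ * ‖(b - a) • F t - y‖ ^ 2 := by
      rw [norm_sub_sq_real, norm_smul, real_inner_smul_left, mul_pow, Real.norm_eq_abs, sq_abs,
        real_inner_comm]
      field_simp
    rw [h1]
    positivity
  rw [intervalIntegral.integral_add (hi1.sub hi2) hi3, intervalIntegral.integral_sub hi1 hi2,
    intervalIntegral.integral_const_mul, intervalIntegral.integral_const_mul, hin,
    intervalIntegral.integral_const, smul_eq_mul, mul_inv_cancel_left₀ hpos.ne'] at h0
  linarith

theorem C1On.norm_sub_sq_le [CompleteSpace H] {u u' : ℝ → H} (hu : C1On a b u u') {t : ℝ}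
    (ht : t ∈ Icc a b) :
    ‖u t - u a‖ ^ 2 ≤ (b - a) * ∫ s in a..b, ‖u' s‖ ^ 2 := by
  have hint : IntervalIntegrable (fun s => ‖u' s‖ ^ 2) volume a b :=
    ContinuousOn.intervalIntegrable (by
      rw [uIcc_of_le (ht.1.trans ht.2)]; exact hu.cont'.norm.pow 2)
  have hnn : 0 ≤ ∫ s in a..b, ‖u' s‖ ^ 2 :=
    intervalIntegral.integral_nonneg (ht.1.trans ht.2) fun _ _ => sq_nonneg _
  rcases ht.1.eq_or_lt with rfl | hat
  · simpa using mul_nonneg (sub_nonneg.2 (ht.1.trans ht.2)) hnn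
  have h1 := norm_integral_sq_le hat (hu.mono le_rfl ht.2).cont'
  rw [(hu.mono le_rfl ht.2).integral_eq_sub ht.1] at h1
  have h2 : ∫ s in a..t, ‖u' s‖ ^ 2 ≤ ∫ s in a..b, ‖u' s‖ ^ 2 :=
    intervalIntegral.integral_mono_interval le_rfl ht.1 ht.2
      (Filter.Eventually.of_forall fun _ => sq_nonneg _) hint
  refine h1.trans (mul_le_mul (by linarith [ht.2]) h2 ?_ (by linarith [ht.1, ht.2]))
  exact intervalIntegral.integral_nonneg ht.1 fun _ _ => sq_nonneg _

theorem C1On.integral_inner_eq {u u' : ℝ → H} (hu : C1On a b u u') (hab : a ≤ b) :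
    ∫ t in a..b, inner ℝ (u t) (u' t) = (‖u b‖ ^ 2 - ‖u a‖ ^ 2) / 2 := by
  have h : C1On a b (fun t => ‖u t‖ ^ 2) fun t => 2 * inner ℝ (u t) (u' t) :=
    ⟨fun t ht => (hu.hasDerivAt t ht).norm_sq, hu.cont.norm.pow 2,
      continuousOn_const.mul (hu.cont.inner hu.cont')⟩
  have := h.integral_eq_sub hab
  rw [intervalIntegral.integral_const_mul] at this
  linarith

end

/-! ### The energy estimate on one interval -/

section

variable {d : ℕ} {Ω : Set (EuclideanSpace ℝ (Fin d))}

/-- The error of `Π_N` in time is orthogonal, after differentiation, to polynomials of lower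
degree. -/
theorem IsTimeProj.integral_inner_eq_zero {V H : Type*} [NormedAddCommGroup V] [NormedSpace ℝ V]
    [CompleteSpace V] [NormedAddCommGroup H] [InnerProductSpace ℝ H] [CompleteSpace H] {m : ℕ}
    {a b : ℝ} (hab : a ≤ b) {u u' p : ℝ → V} (hu' : ContinuousOn u' (Icc a b))
    (hp : IsTimeProj m a b u u' p) (A : V →L[ℝ] H) {r : ℝ → H}
    (hr : r ∈ timePoly m (univ : Set H)) :
    ∫ t in a..b, inner ℝ (A (deriv p t - u' t)) (r t) = 0 := by
  obtain ⟨c, -, hrc⟩ := hr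
  have hpc : Continuous (deriv p) :=
    timePoly_continuous (timePoly_deriv_mem (Y := (⊤ : Submodule ℝ V)) (by simpa using hp.mem))
  rw [← uIcc_of_le hab] at hu'
  have hco : ∀ i : ℕ, ContinuousOn (fun t : ℝ => t ^ i • (u' t - deriv p t)) (uIcc a b) := fun i =>
    (continuous_pow i).continuousOn.smul (hu'.sub hpc.continuousOn)
  have hdecomp : ∀ t, inner ℝ (A (deriv p t - u' t)) (r t) = ∑ i ∈ Finset.range (m + 1),
      ((innerSL ℝ (-c i)).comp A) (t ^ i • (u' t - deriv p t)) := by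
    intro t
    rw [hrc, inner_sum]
    refine Finset.sum_congr rfl fun i _ => ?_
    rw [ContinuousLinearMap.comp_apply, innerSL_apply_apply, map_smul, inner_smul_right,
      inner_smul_right, ← neg_sub (u' t), map_neg, inner_neg_left, inner_neg_left, real_inner_comm]
  simp only [hdecomp]
  have hint : ∀ i : ℕ, IntervalIntegrable
      (fun t : ℝ => ((innerSL ℝ (-c i)).comp A) (t ^ i • (u' t - deriv p t))) volume a b := fun i =>
    (((innerSL ℝ (-c i)).comp A).continuous.comp_continuousOn (hco i)).intervalIntegrable
  rw [intervalIntegral.integral_finsetSum fun i _ => hint i]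
  refine Finset.sum_eq_zero fun i hi => ?_
  have h0 := hp.orth (X ^ i) (by rw [degree_X_pow]; exact_mod_cast Finset.mem_range.1 hi)
  simp only [eval_pow, eval_X] at h0
  rw [ContinuousLinearMap.intervalIntegral_comp_comm _ (hco i).intervalIntegrable, h0, map_zero]

/-- `O`, `Fs` and `Fw` stand for the time projection error, the scheme and the weak form, each
tested with `ρ_t`. Their integrals vanish, so they may be put into the pointwise estimate at will.
-/
theorem integral_bound {a b : ℝ} (hab : a ≤ b) {R E O Fs Fw A Λ : ℝ → ℝ}
    (hR : ContinuousOn R (Icc a b)) (hE : ContinuousOn E (Icc a b)) (hO : ContinuousOn O (Icc a b))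
    (hFs : ContinuousOn Fs (Icc a b)) (hFw : ContinuousOn Fw (Icc a b))
    (hA : ContinuousOn A (Icc a b)) (hΛ : ContinuousOn Λ (Icc a b)) {κ K : ℝ}
    (hle : ∀ t ∈ Icc a b, 3 / 4 * R t + E t + O t - (Fs t - Fw t) ≤ 6 * A t + κ * Λ t + K)
    (hO0 : ∫ t in a..b, O t = 0) (hFs0 : ∫ t in a..b, Fs t = 0) (hFw0 : ∫ t in a..b, Fw t = 0) :
    3 / 4 * (∫ t in a..b, R t) + ∫ t in a..b, E t ≤
      6 * (∫ t in a..b, A t) + κ * (∫ t in a..b, Λ t) + (b - a) * K := by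
  have ii : ∀ {F : ℝ → ℝ}, ContinuousOn F (Icc a b) → IntervalIntegrable F volume a b :=
    fun hF => ContinuousOn.intervalIntegrable (by rwa [uIcc_of_le hab])
  have h1 := intervalIntegral.integral_mono_on hab
    (((((ii hR).const_mul (3 / 4)).add (ii hE)).add (ii hO)).sub ((ii hFs).sub (ii hFw)))
    ((((ii hA).const_mul 6).add ((ii hΛ).const_mul κ)).add intervalIntegrable_const) hle
  rw [intervalIntegral.integral_sub ((((ii hR).const_mul (3 / 4)).add (ii hE)).add (ii hO))
      ((ii hFs).sub (ii hFw)),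
    intervalIntegral.integral_add (((ii hR).const_mul (3 / 4)).add (ii hE)) (ii hO),
    intervalIntegral.integral_add ((ii hR).const_mul (3 / 4)) (ii hE),
    intervalIntegral.integral_sub (ii hFs) (ii hFw),
    intervalIntegral.integral_add (((ii hA).const_mul 6).add ((ii hΛ).const_mul κ))
      intervalIntegrable_const,
    intervalIntegral.integral_add ((ii hA).const_mul 6) ((ii hΛ).const_mul κ),
    intervalIntegral.integral_const_mul, intervalIntegral.integral_const_mul,
    intervalIntegral.integral_const_mul, intervalIntegral.integral_const, hO0, hFs0, hFw0,
    smul_eq_mul] at h1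
  linarith

/-- Young's inequality three times, giving `1/24`, `1/24` and `1/6` of the square of `r`, in total
`1/4`; the complementary constants are `6`, `6` and `3/2`. -/
theorem young_bound {H : Type*} [NormedAddCommGroup H] [InnerProductSpace ℝ H] {ε L : ℝ}
    (hε : 0 < ε) (r A Λ G D : H) (hG : ‖G‖ ≤ L * ‖D‖) :
    -inner ℝ A r + ε * inner ℝ Λ r - 1 / ε * inner ℝ G r ≤
      1 / 4 * ‖r‖ ^ 2 + 6 * ‖A‖ ^ 2 + 6 * ε ^ 2 * ‖Λ‖ ^ 2 + L ^ 2 / ε ^ 2 * (3 / 2 * ‖D‖ ^ 2) := by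
  have h1 : -inner ℝ A r ≤ ‖A‖ * ‖r‖ := (neg_le_abs _).trans (abs_real_inner_le_norm A r)
  have h2 : ε * inner ℝ Λ r ≤ ε * (‖Λ‖ * ‖r‖) :=
    mul_le_mul_of_nonneg_left (real_inner_le_norm Λ r) hε.le
  have h3 : -(1 / ε * inner ℝ G r) ≤ 1 / ε * (L * ‖D‖ * ‖r‖) := by
    rw [← mul_neg]
    refine mul_le_mul_of_nonneg_left ?_ (by positivity)
    exact ((neg_le_abs _).trans (abs_real_inner_le_norm G r)).trans
      (mul_le_mul_of_nonneg_right hG (norm_nonneg _))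
  set x := L / ε * ‖D‖ with hx
  have h4 : 1 / ε * (L * ‖D‖ * ‖r‖) = x * ‖r‖ := by rw [hx]; ring
  have h5 : L ^ 2 / ε ^ 2 * (3 / 2 * ‖D‖ ^ 2) = 3 / 2 * x ^ 2 := by rw [hx]; ring
  rw [h4] at h3
  rw [h5]
  nlinarith [sq_nonneg (12 * ‖A‖ - ‖r‖), sq_nonneg (12 * (ε * ‖Λ‖) - ‖r‖), sq_nonneg (3 * x - ‖r‖)]

/-- Subtraction of the two tested equations at one time. `Q` stands for `Π_N u`, `P` for `Π u` and
`w` for `Π_M^0 u`. The time error passes through `Q'` and the gradient error through `w`, so that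
`hell` removes the elliptic part and `hlap` turns the rest into a Laplacian. -/
theorem error_identity {ε S : ℝ} {h h' u u' ρ ρ' P P' Q' w : H01 Ω} {Λ Gg Gu : L2 Ω}
    (hh : h = ρ + P) (hh' : h' = ρ' + P')
    (hlap : inner ℝ Λ (toL2 ρ') = -inner ℝ (grad (P - w)) (grad ρ'))
    (hell : inner ℝ (grad (w - u)) (grad ρ') = (0 : ℝ)) :
    3 / 4 * ‖toL2 ρ'‖ ^ 2
        + (ε * inner ℝ (grad ρ) (grad ρ') + S / ε * inner ℝ (toL2 ρ) (toL2 ρ'))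
        + inner ℝ (toL2 (Q' - u')) (toL2 ρ')
        - ((inner ℝ (toL2 h') (toL2 ρ') + ε * inner ℝ (grad h) (grad ρ')
              + S / ε * inner ℝ (toL2 h) (toL2 ρ') + 1 / ε * inner ℝ Gg (toL2 ρ'))
          - (inner ℝ (toL2 u') (toL2 ρ') + ε * inner ℝ (grad u) (grad ρ')
              + 1 / ε * (inner ℝ Gu (toL2 ρ') + S * inner ℝ (toL2 u) (toL2 ρ')))) =
      -inner ℝ (toL2 (P' - Q') + (S / ε) • toL2 (P - u)) (toL2 ρ') + ε * inner ℝ Λ (toL2 ρ')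
        - 1 / ε * inner ℝ (Gg - Gu) (toL2 ρ') - 1 / 4 * ‖toL2 ρ'‖ ^ 2 := by
  subst hh hh'
  rw [hlap]
  simp only [toL2_add, toL2_sub, grad_add, grad_sub, inner_add_left, inner_sub_left,
    real_inner_smul_left, real_inner_self_eq_norm_sq] at hell ⊢
  linear_combination (-ε) * hell

set_option maxHeartbeats 1000000 in
/-- The energy estimate on one time interval, before the extrapolation error is bounded. -/
theorem energy_inequality (hd : 0 < d) (hΩo : IsOpen Ω) (hΩb : Bornology.IsBounded Ω)
    {f : ℝ → ℝ} (hf : Differentiable ℝ f) {ε L S : ℝ} (hε : 0 < ε) (hL : 0 ≤ L)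
    (hfL : ∀ y, |deriv f y - S| ≤ L) {M m : ℕ} {a b : ℝ} (hab : a < b)
    {u u' g h Q P ρ : ℝ → H01 Ω} (hu : C1On a b u u') (hsol : IsWeakSolution f ε a b u)
    (hg : g ∈ discreteSpace Ω M (m + 1)) (hstep : IsSemiImplicitStep f ε S M (m + 1) a b g h)
    (hQ : Q = timeProj (m + 1) a b u)
    (hP : P = timeProj (m + 1) a b (fun t => spaceProj M (u t))) (hρ : ρ = fun t => h t - P t)
    {K : ℝ} (hK : ∀ t ∈ Icc a b, 3 / 2 * ‖toL2 (g t - u t)‖ ^ 2 ≤ K) :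
    3 / 4 * (∫ t in a..b, ‖toL2 (deriv ρ t)‖ ^ 2)
        + (ε / 2 * (‖grad (ρ b)‖ ^ 2 - ‖grad (ρ a)‖ ^ 2)
          + S / (2 * ε) * (‖toL2 (ρ b)‖ ^ 2 - ‖toL2 (ρ a)‖ ^ 2)) ≤
      6 * (∫ t in a..b, ‖toL2 (deriv (fun s => spaceProj M (Q s) - Q s) t)
          + (S / ε) • toL2 (P t - u t)‖ ^ 2)
        + 6 * ε ^ 2 * (∫ t in a..b, ‖laplacian (P t - spaceProj M (u t))‖ ^ 2)
        + (b - a) * (L ^ 2 / ε ^ 2 * K) := by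
  obtain ⟨A, hA⟩ := exists_spaceProj_clm hd hΩo hΩb M
  obtain ⟨Lap, hLap⟩ := exists_laplacian_clm hΩo hΩb M
  have hAfun : ∀ w : H01 Ω, spaceProj M w = A w := fun w => (hA w).2
  have hAmem : ∀ w : H01 Ω, A w ∈ polySub Ω M := fun w => (hA w).1.1
  obtain ⟨G, hGL, hG⟩ := exists_nemytskii hΩo hΩb (lipschitzWith_sub_mul hf hL hfL)
  simp only [hAfun] at hP ⊢
  obtain ⟨hhmem, -, hscheme⟩ := hstep
  have hQp : IsTimeProj m a b u u' Q := hQ ▸ isTimeProj_timeProj hab hu m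
  have hQT : Q ∈ timePoly (m + 1) ((⊤ : Submodule ℝ (H01 Ω)) : Set (H01 Ω)) := by
    simpa using hQp.mem
  -- Interchanging the projections makes `∂_t(P - Q)` the derivative of `π_M`, and shows that `P`
  -- has coefficients in the polynomial space.
  have hPA : P = fun t => A (Q t) := by rw [hP, hQ]; exact timeProj_map A hab hu m
  have hPmem : P ∈ timePoly (m + 1) (polySub Ω M : Set (H01 Ω)) := by
    rw [hPA]; exact timePoly_map A.toLinearMap (fun y _ => hAmem y) hQp.mem
  have hhm : h ∈ timePoly (m + 1) (polySub Ω M : Set (H01 Ω)) := hhmem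
  have hgm : g ∈ timePoly (m + 1) (polySub Ω M : Set (H01 Ω)) := hg
  have hρmem : ρ ∈ timePoly (m + 1) (polySub Ω M : Set (H01 Ω)) := by
    rw [hρ]; exact timePoly_sub hhm hPmem
  have hρ'mem := timePoly_deriv_mem hρmem
  have hQd := timePoly_hasDerivAt hQT
  have hQ'c := timePoly_continuous (timePoly_deriv_mem hQT)
  have hPd : ∀ t, HasDerivAt P (A (deriv Q t)) t := fun t => by
    rw [hPA]; exact A.hasFDerivAt.comp_hasDerivAt t (hQd t)
  have hhd := timePoly_hasDerivAt hhm
  have hρd := timePoly_hasDerivAt hρmem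
  have hh't : ∀ t, deriv h t = deriv ρ t + A (deriv Q t) := fun t => by
    have : HasDerivAt ρ (deriv h t - A (deriv Q t)) t := by
      rw [hρ]; exact (hhd t).sub (hPd t)
    rw [this.deriv]; abel
  have hht : ∀ t, h t = ρ t + P t := fun t => by rw [hρ]; simp
  have hMd : ∀ t, deriv (fun s => A (Q s) - Q s) t = A (deriv Q t) - deriv Q t := fun t =>
    ((A.hasFDerivAt.comp_hasDerivAt t (hQd t)).sub (hQd t)).deriv
  -- continuity
  have hρC : C1On a b ρ (deriv ρ) := C1On.of_timePoly hρmem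
  have c_r : Continuous fun t => toL2 (deriv ρ t) :=
    toL2L.continuous.comp (timePoly_continuous hρ'mem)
  have c_dr : Continuous fun t => grad (deriv ρ t) :=
    gradL.continuous.comp (timePoly_continuous hρ'mem)
  have c_h' : Continuous fun t => toL2 (deriv h t) :=
    toL2L.continuous.comp (timePoly_continuous (timePoly_deriv_mem hhm))
  have c_h : Continuous fun t => toL2 (h t) := toL2L.continuous.comp (timePoly_continuous hhm)
  have c_dh : Continuous fun t => grad (h t) := gradL.continuous.comp (timePoly_continuous hhm)
  have c_ρ : Continuous fun t => toL2 (ρ t) := toL2L.continuous.comp (timePoly_continuous hρmem)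
  have c_dρ : Continuous fun t => grad (ρ t) := gradL.continuous.comp (timePoly_continuous hρmem)
  have c_g : Continuous fun t => G (toL2 (g t)) :=
    hGL.continuous.comp (toL2L.continuous.comp (timePoly_continuous hgm))
  have c_u' : ContinuousOn (fun t => toL2 (u' t)) (Icc a b) :=
    toL2L.continuous.comp_continuousOn hu.cont'
  have c_u : ContinuousOn (fun t => toL2 (u t)) (Icc a b) :=
    toL2L.continuous.comp_continuousOn hu.cont
  have c_du : ContinuousOn (fun t => grad (u t)) (Icc a b) :=
    gradL.continuous.comp_continuousOn hu.cont
  have c_Gu : ContinuousOn (fun t => G (toL2 (u t))) (Icc a b) :=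
    hGL.continuous.comp_continuousOn c_u
  have c_O : ContinuousOn (fun t => toL2 (deriv Q t - u' t)) (Icc a b) :=
    toL2L.continuous.comp_continuousOn (hQ'c.continuousOn.sub hu.cont')
  have c_M : Continuous fun t => toL2 (A (deriv Q t) - deriv Q t) :=
    toL2L.continuous.comp ((A.continuous.comp hQ'c).sub hQ'c)
  have c_π : ContinuousOn (fun t => toL2 (P t - u t)) (Icc a b) :=
    toL2L.continuous.comp_continuousOn ((timePoly_continuous hPmem).continuousOn.sub hu.cont)
  have hlapmem : ∀ t, P t - A (u t) ∈ polySub Ω M := fun t =>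
    (polySub Ω M).sub_mem (timePoly_mem hPmem t) (hAmem _)
  have c_Λ : ContinuousOn (fun t => laplacian (P t - A (u t))) (Icc a b) := by
    have : (fun t => laplacian (P t - A (u t))) = fun t => Lap ⟨P t - A (u t), hlapmem t⟩ :=
      funext fun t => (hLap ⟨_, hlapmem t⟩).2
    rw [this]
    refine Lap.continuous.comp_continuousOn
      (Topology.IsInducing.subtypeVal.continuousOn_iff.2 ?_)
    exact (timePoly_continuous hPmem).continuousOn.sub (A.continuous.comp_continuousOn hu.cont)
  -- the scheme and the weak form, tested with `ρ`
  have hFs0 : ∫ t in a..b, (inner ℝ (toL2 (deriv h t)) (toL2 (deriv ρ t))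
      + ε * inner ℝ (grad (h t)) (grad (deriv ρ t))
      + S / ε * inner ℝ (toL2 (h t)) (toL2 (deriv ρ t))
      + 1 / ε * inner ℝ (G (toL2 (g t))) (toL2 (deriv ρ t))) = 0 := by
    -- The constant gives the test function its prescribed value at `a` and leaves its derivative
    -- unchanged. The weak form is treated the same way.
    have hv := hscheme (ρ + fun _ => g a - ρ a) (timePoly_add hρmem (timePoly_const (m + 1)
      ((polySub Ω M).sub_mem (timePoly_mem hgm a) (timePoly_mem hρmem a)))) (by simp)
    rw [← hv]
    refine intervalIntegral.integral_congr fun t _ => ?_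
    have hd' : deriv (ρ + fun _ => g a - ρ a) t = deriv ρ t := ((hρd t).add_const _).deriv
    simp only [hd', nonlinPair_eq_inner (g := fun y => f y - S * y) hG]
  have hFw0 : ∫ t in a..b, (inner ℝ (toL2 (u' t)) (toL2 (deriv ρ t))
      + ε * inner ℝ (grad (u t)) (grad (deriv ρ t))
      + 1 / ε * (inner ℝ (G (toL2 (u t))) (toL2 (deriv ρ t))
        + S * inner ℝ (toL2 (u t)) (toL2 (deriv ρ t)))) = 0 := by
    obtain ⟨w, hw, hweak⟩ := hsol
    have hvC : C1On a b (ρ + fun _ => u a - ρ a) (deriv ρ) :=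
      C1On.of_hasDerivAt (fun t => (hρd t).add_const _) (timePoly_continuous hρ'mem)
    rw [← hweak _ _ hvC.hasTimeDeriv (by simp)]
    refine intervalIntegral.integral_congr_ae ?_
    rw [uIoc_of_le hab.le]
    filter_upwards [hw.ae_eq hu hab.le] with t ht hmem
    rw [ht hmem, nonlinPair_eq_inner_add hG]
  have hO0 : ∫ t in a..b, inner ℝ (toL2 (deriv Q t - u' t)) (toL2 (deriv ρ t)) = 0 :=
    hQp.integral_inner_eq_zero hab.le hu.cont' toL2L
      (timePoly_map toL2L.toLinearMap (fun _ _ => mem_univ _) hρ'mem)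
  have hE0 : ∫ t in a..b, (ε * inner ℝ (grad (ρ t)) (grad (deriv ρ t))
      + S / ε * inner ℝ (toL2 (ρ t)) (toL2 (deriv ρ t))) =
      ε / 2 * (‖grad (ρ b)‖ ^ 2 - ‖grad (ρ a)‖ ^ 2)
        + S / (2 * ε) * (‖toL2 (ρ b)‖ ^ 2 - ‖toL2 (ρ a)‖ ^ 2) := by
    have e1 := (hρC.map gradL).integral_inner_eq hab.le
    have e2 := (hρC.map toL2L).integral_inner_eq hab.le
    simp only [gradL_apply, toL2L_apply] at e1 e2
    rw [intervalIntegral.integral_add (Continuous.intervalIntegrable (by fun_prop) _ _)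
      (Continuous.intervalIntegrable (by fun_prop) _ _), intervalIntegral.integral_const_mul,
      intervalIntegral.integral_const_mul, e1, e2]
    ring
  rw [← hE0]
  simp only [hMd]
  refine integral_bound (R := fun t => ‖toL2 (deriv ρ t)‖ ^ 2)
    (Λ := fun t => ‖laplacian (P t - A (u t))‖ ^ 2) hab.le (c_r.norm.pow 2).continuousOn
    ?_ ?_ ?_ ?_ ?_ (c_Λ.norm.pow 2)
    ?_ hO0 hFs0 hFw0
  · exact (((c_dρ.inner c_dr).const_mul ε).add ((c_ρ.inner c_r).const_mul (S / ε))).continuousOn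
  · exact c_O.inner c_r.continuousOn
  · exact ((((c_h'.inner c_r).add ((c_dh.inner c_dr).const_mul ε)).add
      ((c_h.inner c_r).const_mul (S / ε))).add ((c_g.inner c_r).const_mul (1 / ε))).continuousOn
  · exact ((c_u'.inner c_r.continuousOn).add
      (continuousOn_const.mul (c_du.inner c_dr.continuousOn))).add
      (continuousOn_const.mul ((c_Gu.inner c_r.continuousOn).add
        (continuousOn_const.mul (c_u.inner c_r.continuousOn))))
  · exact (c_M.continuousOn.add (c_π.const_smul (S / ε))).norm.pow 2
  intro t ht
  have hlap := (hLap ⟨_, hlapmem t⟩).1 (deriv ρ t)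
  rw [← (hLap ⟨_, hlapmem t⟩).2] at hlap
  have hell := (hA (u t)).1.2 (deriv ρ t) (timePoly_mem hρ'mem t)
  have hGn : ‖G (toL2 (g t)) - G (toL2 (u t))‖ ≤ L * ‖toL2 (g t - u t)‖ := by
    rw [toL2_sub, ← dist_eq_norm, ← dist_eq_norm]
    exact hGL.dist_le_mul _ _
  have hy := young_bound hε (toL2 (deriv ρ t))
    (toL2 (A (deriv Q t) - deriv Q t) + (S / ε) • toL2 (P t - u t))
    (laplacian (P t - A (u t))) _ _ hGn
  have hKt : L ^ 2 / ε ^ 2 * (3 / 2 * ‖toL2 (g t - u t)‖ ^ 2) ≤ L ^ 2 / ε ^ 2 * K :=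
    mul_le_mul_of_nonneg_left (hK t ht) (by positivity)
  refine le_trans (le_of_eq ?_) ((sub_le_sub_right hy (1 / 4 * ‖toL2 (deriv ρ t)‖ ^ 2)).trans
    (by linarith))
  exact error_identity (hht t) (hh't t) hlap hell

end

/-! ### The extrapolation error and the constants of one step -/

section

variable {d : ℕ} {Ω : Set (EuclideanSpace ℝ (Fin d))}

theorem integral_norm_add_sq_le {H : Type*} [NormedAddCommGroup H] [InnerProductSpace ℝ H]
    {a b : ℝ} (hab : a ≤ b) {v w : ℝ → H} (hv : ContinuousOn v (Icc a b))
    (hw : ContinuousOn w (Icc a b)) :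
    ∫ t in a..b, ‖v t + w t‖ ^ 2 ≤
      2 * (∫ t in a..b, ‖v t‖ ^ 2) + 2 * ∫ t in a..b, ‖w t‖ ^ 2 := by
  rw [← uIcc_of_le hab] at hv hw
  have h1 : IntervalIntegrable (fun t => 2 * ‖v t‖ ^ 2) volume a b :=
    (continuousOn_const.mul (hv.norm.pow 2)).intervalIntegrable
  have h2 : IntervalIntegrable (fun t => 2 * ‖w t‖ ^ 2) volume a b :=
    (continuousOn_const.mul (hw.norm.pow 2)).intervalIntegrable
  have h3 : IntervalIntegrable (fun t => ‖v t + w t‖ ^ 2) volume a b :=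
    ((hv.add hw).norm.pow 2).intervalIntegrable
  rw [← intervalIntegral.integral_const_mul, ← intervalIntegral.integral_const_mul,
    ← intervalIntegral.integral_add h1 h2]
  refine intervalIntegral.integral_mono_on hab h3 (h1.add h2) fun t _ => ?_
  have := parallelogram_law_with_norm ℝ (v t) (w t)
  nlinarith [sq_nonneg ‖v t - w t‖]

/-- The derivative of the difference between `u` and the extrapolation of a polynomial `g` to the
next interval, in terms of a polynomial approximation `p` of `u` on the next interval. -/
theorem integral_deriv_extrapolation_le {c a b : ℝ} (hca : c < a) (hb : b = 2 * a - c) {m : ℕ}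
    {u u' g p P : ℝ → H01 Ω} (hu : C1On a b u u') (hg : g ∈ timePoly (m + 1) (univ : Set (H01 Ω)))
    (hp : p ∈ timePoly (m + 1) (univ : Set (H01 Ω)))
    (hP : P ∈ timePoly (m + 1) (univ : Set (H01 Ω))) :
    ∫ t in a..b, ‖toL2 (deriv g t - u' t)‖ ^ 2 ≤
      2 * (extrapConst m ^ 2 * (2 * (∫ t in c..a, ‖toL2 (deriv (fun s => g s - P s) t)‖ ^ 2)
        + 2 * ∫ t in c..a, ‖toL2 (deriv (fun s => p s - P s) t)‖ ^ 2))
      + 2 * ∫ t in a..b, ‖toL2 (deriv (fun s => p s - u s) t)‖ ^ 2 := by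
  have hab : a < b := by linarith
  have htop : ∀ {q : ℝ → H01 Ω}, q ∈ timePoly (m + 1) (univ : Set (H01 Ω)) →
      q ∈ timePoly (m + 1) ((⊤ : Submodule ℝ (H01 Ω)) : Set (H01 Ω)) := fun h => by simpa using h
  have hsub : ∀ {q r : ℝ → H01 Ω}, q ∈ timePoly (m + 1) (univ : Set (H01 Ω)) →
      r ∈ timePoly (m + 1) (univ : Set (H01 Ω)) →
      deriv (fun s => q s - r s) = fun s => deriv q s - deriv r s := fun hq hr =>
    funext fun s => ((timePoly_hasDerivAt (htop hq) s).sub (timePoly_hasDerivAt (htop hr) s)).deriv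
  have hcont : ∀ {q : ℝ → H01 Ω}, q ∈ timePoly (m + 1) (univ : Set (H01 Ω)) →
      Continuous (deriv q) := fun hq => timePoly_continuous (timePoly_deriv_mem (htop hq))
  have hpu : C1On a b (fun s => p s - u s) (fun s => deriv p s - u' s) :=
    (C1On.of_timePoly (htop hp)).sub hu
  have e1 : ∫ t in a..b, ‖toL2 (deriv g t - u' t)‖ ^ 2 =
      ∫ t in a..b, ‖toL2 (deriv g t - deriv p t) + toL2 (deriv p t - u' t)‖ ^ 2 := by
    refine intervalIntegral.integral_congr fun t _ => ?_
    simp only [← toL2_add]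
    rw [sub_add_sub_cancel]
  have e2 := integral_norm_add_sq_le hab.le
    (toL2L.continuous.comp ((hcont hg).sub (hcont hp))).continuousOn
    (toL2L.continuous.comp_continuousOn hpu.cont')
  have e3 : ∫ t in a..b, ‖toL2 (deriv g t - deriv p t)‖ ^ 2 ≤
      extrapConst m ^ 2 * ∫ t in c..a, ‖toL2 (deriv g t - deriv p t)‖ ^ 2 := by
    have hmem : (fun t => toL2 (deriv g t - deriv p t)) ∈ timePoly m (univ : Set (L2 Ω)) :=
      timePoly_map toL2L.toLinearMap (fun _ _ => mem_univ _)
        (timePoly_sub (timePoly_deriv_mem (htop hg)) (timePoly_deriv_mem (htop hp)))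
    rw [hb]
    exact extrapolation hca hmem
  have e4 : ∫ t in c..a, ‖toL2 (deriv g t - deriv p t)‖ ^ 2 =
      ∫ t in c..a, ‖toL2 (deriv g t - deriv P t) + toL2 (deriv P t - deriv p t)‖ ^ 2 := by
    refine intervalIntegral.integral_congr fun t _ => ?_
    simp only [← toL2_add]
    rw [sub_add_sub_cancel]
  have e5 := integral_norm_add_sq_le hca.le
    (toL2L.continuous.comp ((hcont hg).sub (hcont hP))).continuousOn
    (toL2L.continuous.comp ((hcont hP).sub (hcont hp))).continuousOn
  have e6 : ∫ t in c..a, ‖toL2 (deriv p t - deriv P t)‖ ^ 2 =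
      ∫ t in c..a, ‖toL2 (deriv P t - deriv p t)‖ ^ 2 := by
    refine intervalIntegral.integral_congr fun t _ => ?_
    simp only [toL2_sub]
    rw [norm_sub_rev]
  have e7 := hpu.integral_congr hab.le fun _ x => ‖toL2 x‖ ^ 2
  simp only [toL2L_apply, Pi.sub_apply, Function.comp_def] at e2 e5
  rw [e7, hsub hg hP, hsub hp hP, e6, e1]
  refine e2.trans ?_
  have e8 := e3.trans (mul_le_mul_of_nonneg_left (e4.trans_le e5) (sq_nonneg (extrapConst m)))
  linarith

/-- Cauchy-Schwarz with weights `3/8`, `3/8` and `1/4`, whose sum is one. -/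
theorem weighted_norm_bound {H : Type*} [NormedAddCommGroup H] (x y z : H) :
    3 / 2 * ‖x + y + z‖ ^ 2 ≤ 4 * ‖x‖ ^ 2 + 4 * ‖y‖ ^ 2 + 6 * ‖z‖ ^ 2 := by
  have h := norm_add₃_le (a := x) (b := y) (c := z)
  have h2 := pow_le_pow_left₀ (norm_nonneg _) h 2
  nlinarith [sq_nonneg (‖x‖ - ‖y‖), sq_nonneg (2 * ‖x‖ - 3 * ‖z‖), sq_nonneg (2 * ‖y‖ - 3 * ‖z‖)]

/-- Young's inequality for the cross term. With `θ = τ L / ε` the growth is `4 θ`, and `τ / (4 θ) =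
ε / (4 L)` is a fixed share of the available coefficient of `R`. -/
theorem endpoint_norm_bound {H : Type*} [NormedAddCommGroup H] {θ : ℝ} (hθ : 0 < θ) (x y : H) :
    ‖y‖ ^ 2 ≤ (1 + 4 * θ) * ‖x‖ ^ 2 + (1 + 1 / (4 * θ)) * ‖y - x‖ ^ 2 := by
  have h : ‖y‖ ≤ ‖x‖ + ‖y - x‖ := by simpa using norm_add_le x (y - x)
  have h2 := pow_le_pow_left₀ (norm_nonneg _) h 2
  have h3 : 0 ≤ (4 * θ * ‖x‖ - ‖y - x‖) ^ 2 / (4 * θ) := by positivity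
  have h4 : (4 * θ * ‖x‖ - ‖y - x‖) ^ 2 / (4 * θ) =
      4 * θ * ‖x‖ ^ 2 - 2 * (‖x‖ * ‖y - x‖) + 1 / (4 * θ) * ‖y - x‖ ^ 2 := by
    field_simp
    ring
  nlinarith

/-- Put `θ = τ L / ε` and add `ε / L` times `hE`, `hX`, and `6 L τ² / ε` times `hZ`. The growth of
`xa` is `4 θ` from `hE` and `4 θ` from `hX`, in total `D_2 τ`; the coefficient of `Rp` is `D_3 τ`.
In `D_τ + D_3 τ` the terms with `c₂` cancel, leaving `ε / L * (1/4 - 4 θ²)`, while `ε / L * (1/2 -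
θ)` is available for `R`. The surplus is nonnegative for every `θ` (`n5`). The factor `c₂` on `Q` is
afforded by `1 ≤ c₂` (`n4`). -/
theorem step_algebra {ε L S τ c₂ R Rp xa xb ga gb A Λ y Q Q' Z : ℝ} (hε : 0 < ε) (hL : 0 < L)
    (hS : 0 ≤ S) (hτ : 0 < τ) (hc : 1 ≤ c₂) (hR : 0 ≤ R) (hRp : 0 ≤ Rp) (hxa : 0 ≤ xa)
    (hga : 0 ≤ ga) (hQ : 0 ≤ Q)
    (hE : 3 / 4 * R + (ε / 2 * (gb - ga) + S / (2 * ε) * (xb - xa)) ≤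
      6 * A + 6 * ε ^ 2 * Λ + τ * (L ^ 2 / ε ^ 2 * (4 * xa + 4 * y + 6 * (τ * Z))))
    (hX : xb ≤ (1 + 4 * (τ * L / ε)) * xa + (1 + 1 / (4 * (τ * L / ε))) * (τ * R))
    (hZ : Z ≤ 2 * (c₂ * (2 * Rp + 2 * Q')) + 2 * Q) :
    (1 + S / (2 * L)) * xb + ε ^ 2 / (2 * L) * gb
        + ε / L * (1 / 4 - 4 * τ ^ 2 * L ^ 2 * (1 + 6 * c₂) / ε ^ 2) * R
        + 24 * L * τ * c₂ / ε * τ * R ≤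
      (1 + 8 * L / ε * τ) * ((1 + S / (2 * L)) * xa + ε ^ 2 / (2 * L) * ga
          + 24 * L * τ * c₂ / ε * τ * Rp)
        + ε / L * (6 * A + 6 * ε ^ 2 * Λ + 4 * L ^ 2 * τ / ε ^ 2 * y
          + 12 * L ^ 2 * τ ^ 2 * c₂ / ε ^ 2 * (Q + 2 * Q')) := by
  have n1 := mul_nonneg (div_pos hε hL).le (sub_nonneg.2 hE)
  have n2 := sub_nonneg.2 hX
  have n3 : 0 ≤ 6 * L * τ ^ 2 / ε * (2 * (c₂ * (2 * Rp + 2 * Q')) + 2 * Q - Z) :=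
    mul_nonneg (by positivity) (sub_nonneg.2 hZ)
  have n4 : 0 ≤ 12 * L * τ ^ 2 / ε * ((c₂ - 1) * Q) :=
    mul_nonneg (by positivity) (mul_nonneg (sub_nonneg.2 hc) hQ)
  have n5 : 0 ≤ ε / L * ((1 / 4 - τ * L / ε + 4 * (τ * L / ε) ^ 2) * R) :=
    mul_nonneg (by positivity) (mul_nonneg (by nlinarith [sq_nonneg (8 * (τ * L / ε) - 1)]) hR)
  have hc0 : 0 ≤ c₂ := zero_le_one.trans hc
  have n6 : 0 ≤ 8 * L / ε * τ * (S / (2 * L) * xa + ε ^ 2 / (2 * L) * ga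
      + 24 * L * τ * c₂ / ε * τ * Rp) := by positivity
  rw [← sub_nonneg]
  refine (add_nonneg (add_nonneg (add_nonneg (add_nonneg (add_nonneg n1 n2) n3) n4) n5)
    n6).trans_eq ?_
  field_simp
  ring

end

/-! ### The error recursion and its summation -/

section

variable {d : ℕ} {Ω : Set (EuclideanSpace ℝ (Fin d))}

theorem node_succ (τ : ℝ) (k : ℕ) : node τ (k + 1) = node τ k + τ := by
  simp [node, add_mul]

theorem node_nonneg {τ : ℝ} (hτ : 0 ≤ τ) (k : ℕ) : 0 ≤ node τ k :=
  mul_nonneg (Nat.cast_nonneg k) hτ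

theorem isTimeProj_fullProj (hd : 0 < d) (hΩo : IsOpen Ω) (hΩb : Bornology.IsBounded Ω) (M m : ℕ)
    {τ : ℝ} (hτ : 0 < τ) (k : ℕ) {u u' : ℝ → H01 Ω} (hu : C1On (node τ k) (node τ (k + 1)) u u') :
    ∃ w', IsTimeProj m (node τ k) (node τ (k + 1)) (fun t => spaceProj M (u t)) w'
      (fullProj M (m + 1) τ (k + 1) u) := by
  obtain ⟨A, hA⟩ := exists_spaceProj_clm hd hΩo hΩb M
  have h : (fun t => spaceProj M (u t)) = fun t => A (u t) := funext fun t => (hA (u t)).2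
  refine ⟨fun t => A (u' t), ?_⟩
  rw [fullProj, h]
  exact isTimeProj_timeProj (by rw [node_succ]; linarith) (hu.map A) m

/-- One step of the error recursion. -/
theorem error_step (hd : 0 < d) (hΩo : IsOpen Ω) (hΩb : Bornology.IsBounded Ω)
    {f : ℝ → ℝ} (hf : Differentiable ℝ f) {ε L S : ℝ} (hε : 0 < ε) (hL : 0 < L) (hS : 0 ≤ S)
    (hfL : ∀ y, |deriv f y - S| ≤ L) {M m : ℕ} {T τ : ℝ} (hτ : 0 < τ) {u u' : ℝ → H01 Ω}
    (hu : C1On 0 T u u') {j : ℕ} (hjT : node τ (j + 2) ≤ T)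
    (hsol : IsWeakSolution f ε (node τ (j + 1)) (node τ (j + 2)) u) {h : ℕ → ℝ → H01 Ω}
    (hprev : h (j + 1) ∈ discreteSpace Ω M (m + 1))
    (hstep : IsSemiImplicitStep f ε S M (m + 1) (node τ (j + 1)) (node τ (j + 2))
      (h (j + 1)) (h (j + 2))) :
    (1 + S / (2 * L)) * ‖toL2 (rho M (m + 1) τ u h (j + 2) (node τ (j + 2)))‖ ^ 2
        + ε ^ 2 / (2 * L) * ‖grad (rho M (m + 1) τ u h (j + 2) (node τ (j + 2)))‖ ^ 2
        + Dtau ε L τ (m + 1) *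
          slabNormSq τ (j + 2) (fun t => toL2 (deriv (rho M (m + 1) τ u h (j + 2)) t))
        + D3 ε L τ (m + 1) * τ *
          slabNormSq τ (j + 2) (fun t => toL2 (deriv (rho M (m + 1) τ u h (j + 2)) t)) ≤
      (1 + D2 ε L * τ) *
          ((1 + S / (2 * L)) * ‖toL2 (rho M (m + 1) τ u h (j + 1) (node τ (j + 1)))‖ ^ 2
            + ε ^ 2 / (2 * L) * ‖grad (rho M (m + 1) τ u h (j + 1) (node τ (j + 1)))‖ ^ 2
            + D3 ε L τ (m + 1) * τ *
              slabNormSq τ (j + 1) (fun t => toL2 (deriv (rho M (m + 1) τ u h (j + 1)) t)))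
        + Ehat ε L S M (m + 1) T τ u (j + 2) := by
  set c := node τ j with hc
  set a := node τ (j + 1) with ha
  set b := node τ (j + 2) with hb
  have hac : a = c + τ := node_succ τ j
  have hba : b = a + τ := node_succ τ (j + 1)
  have hca : c < a := by linarith
  have hab : a < b := by linarith
  have hc0 : 0 ≤ c := node_nonneg hτ.le j
  have hua : C1On a b u u' := hu.mono (by linarith) hjT
  have huc : C1On c a u u' := hu.mono hc0 (by linarith)
  obtain ⟨w₁, hP₁⟩ := isTimeProj_fullProj hd hΩo hΩb M m hτ j huc
  obtain ⟨w₂, hP₂⟩ := isTimeProj_fullProj hd hΩo hΩb M m hτ (j + 1) hua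
  rw [← hc, ← ha] at hP₁
  have hP₂a : fullProj M (m + 1) τ (j + 2) u a = spaceProj M (u a) := hP₂.left
  have hP₁a : fullProj M (m + 1) τ (j + 1) u a = spaceProj M (u a) := hP₁.right
  have hha : h (j + 2) a = h (j + 1) a := hstep.2.1
  -- The errors of adjacent intervals agree at the common node: the scheme is continuous there, and
  -- both time projections interpolate `spaceProj M (u a)`.
  have hρa : rho M (m + 1) τ u h (j + 2) a = rho M (m + 1) τ u h (j + 1) a := by
    simp only [rho, hP₁a, hP₂a, hha]
  have htop : ∀ {q : ℝ → H01 Ω}, q ∈ timePoly (m + 1) (univ : Set (H01 Ω)) →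
      q ∈ timePoly (m + 1) ((⊤ : Submodule ℝ (H01 Ω)) : Set (H01 Ω)) := fun h => by simpa using h
  have hgT := timePoly_mono (subset_univ _) hprev
  have hhT := timePoly_mono (subset_univ _) hstep.1
  have hgu := (C1On.of_timePoly (a := a) (b := b) (htop hgT)).sub hua
  set Z := ∫ t in a..b, ‖toL2 (deriv (h (j + 1)) t - u' t)‖ ^ 2 with hZ
  have hZle := integral_deriv_extrapolation_le hca (by linarith : b = 2 * a - c) hua hgT
    (taylorWithinEval_mem_timePoly (fun s => spaceProj M (u s)) (m + 1) (Icc 0 T) a) hP₁.mem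
  have hE := energy_inequality hd hΩo hΩb hf hε hL.le hfL hab hua hsol hprev hstep rfl rfl
    (ρ := rho M (m + 1) τ u h (j + 2)) rfl
    (K := 4 * ‖toL2 (rho M (m + 1) τ u h (j + 1) a)‖ ^ 2
      + 4 * ‖toL2 (projErr M (m + 1) τ (j + 2) u a)‖ ^ 2 + 6 * (τ * Z)) (by
    intro t ht
    have hD := (hgu.map toL2L).norm_sub_sq_le ht
    simp only [toL2L_apply, Pi.sub_apply] at hD
    rw [show b - a = τ by linarith, ← hZ] at hD
    -- At the left node the extrapolation error is `ρ + π`; the remainder is its increment, bounded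
    -- through `Z`.
    have h1 : toL2 (h (j + 1) t - u t) = toL2 (rho M (m + 1) τ u h (j + 1) a)
        + toL2 (projErr M (m + 1) τ (j + 2) u a)
        + (toL2 (h (j + 1) t - u t) - toL2 (h (j + 1) a - u a)) := by
      simp only [rho, projErr, hP₁a, hP₂a, toL2_sub]
      abel
    rw [h1]
    refine (weighted_norm_bound _ _ _).trans ?_
    linarith)
  have hρC : C1On a b (rho M (m + 1) τ u h (j + 2)) (deriv (rho M (m + 1) τ u h (j + 2))) :=
    C1On.of_timePoly (timePoly_sub (htop hhT) (htop hP₂.mem))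
  have hX := endpoint_norm_bound (θ := τ * L / ε) (by positivity)
    (toL2 (rho M (m + 1) τ u h (j + 2) a)) (toL2 (rho M (m + 1) τ u h (j + 2) b))
  have hXR := (hρC.map toL2L).norm_sub_sq_le (right_mem_Icc.2 hab.le)
  simp only [toL2L_apply] at hXR
  rw [show b - a = τ by linarith] at hXR hE
  have hX' := hX.trans (add_le_add_right (mul_le_mul_of_nonneg_left hXR
    (by positivity : 0 ≤ 1 + 1 / (4 * (τ * L / ε)))) _)
  rw [hρa] at hE hX'
  have hint : ∀ (x y : ℝ) (v : ℝ → L2 Ω), x ≤ y → 0 ≤ ∫ t in x..y, ‖v t‖ ^ 2 := fun x y v hxy =>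
    intervalIntegral.integral_nonneg hxy fun _ _ => sq_nonneg _
  exact step_algebra hε hL hS hτ (one_le_extrapConst_sq m) (hint _ _ _ hab.le) (hint _ _ _ hca.le)
    (sq_nonneg _) (sq_nonneg _) (hint _ _ _ hab.le) hE hX' hZle

/-- The only use of the step size restriction: squared, it is exactly this sign. The estimate of a
single step holds without it. -/
theorem Dtau_nonneg {ε L τ : ℝ} (hε : 0 < ε) (hL : 0 < L) (hτ : 0 < τ) (N : ℕ)
    (hτle : τ ≤ ε / (4 * L * √(6 * extrapConst (N - 1) ^ 2 + 1))) : 0 ≤ Dtau ε L τ N := by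
  have hc : 0 < 6 * extrapConst (N - 1) ^ 2 + 1 := by positivity
  have hs : 0 < √(6 * extrapConst (N - 1) ^ 2 + 1) := Real.sqrt_pos.2 hc
  rw [le_div_iff₀ (by positivity)] at hτle
  have h2 := pow_le_pow_left₀ (by positivity) hτle 2
  rw [mul_pow, mul_pow, Real.sq_sqrt hc.le] at h2
  refine mul_nonneg (by positivity) (sub_nonneg.2 ?_)
  rw [div_le_iff₀ (by positivity)]
  nlinarith

/-- The `r k` keep weight one because the exponential factors are at least one, so the amplified sum
dominates the plain one. The sum on the left starts at `k = 1`, where the recursion says nothing,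
hence the extra `r 1` on the right. -/
theorem discrete_gronwall {B r E : ℕ → ℝ} {D τ : ℝ} (hDτ : 0 ≤ D * τ) {n : ℕ} (hn : 1 ≤ n)
    (hr : ∀ k, 0 ≤ r k)
    (hrec : ∀ k, 1 ≤ k → k < n → B (k + 1) + r (k + 1) ≤ Real.exp (D * τ) * B k + E (k + 1)) :
    B n + ∑ k ∈ Finset.Icc 1 n, r k ≤
      ∑ k ∈ Finset.Icc 2 n, Real.exp (D * (((n : ℝ) - k) * τ)) * E k
        + Real.exp (D * (((n : ℝ) - 1) * τ)) * B 1 + r 1 := by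
  induction n, hn using Nat.le_induction with
  | base => simp
  | succ n hn ih =>
    have ih' := ih fun k h1 h2 => hrec k h1 (by omega)
    have h1 := hrec n hn (Nat.lt_succ_self n)
    rw [Finset.sum_Icc_succ_top (by omega : 1 ≤ n + 1),
      Finset.sum_Icc_succ_top (by omega : 2 ≤ n + 1)]
    have hexp : ∀ x : ℝ, Real.exp (D * ((((n + 1 : ℕ) : ℝ) - x) * τ)) =
        Real.exp (D * τ) * Real.exp (D * (((n : ℝ) - x) * τ)) := fun x => by
      rw [← Real.exp_add]
      congr 1
      push_cast
      ring
    have hself : Real.exp (D * ((((n + 1 : ℕ) : ℝ) - ((n + 1 : ℕ) : ℝ)) * τ)) = 1 := by simp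
    rw [hself, one_mul, hexp 1]
    simp only [hexp, mul_assoc]
    rw [← Finset.mul_sum]
    have hle : r 1 ≤ ∑ k ∈ Finset.Icc 1 n, r k :=
      Finset.single_le_sum (fun k _ => hr k) (Finset.mem_Icc.2 ⟨le_rfl, hn⟩)
    have he : 1 ≤ Real.exp (D * τ) := Real.one_le_exp hDτ
    nlinarith [mul_le_mul_of_nonneg_left ih' (zero_le_one.trans he),
      mul_nonneg (sub_nonneg.2 he) (sub_nonneg.2 hle)]

end

end ESET

/-! ### The error estimate -/

theorem theorem4 {d : ℕ} (hd : 0 < d)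
    (Ω : Set (EuclideanSpace ℝ (Fin d))) (hΩo : IsOpen Ω) (hΩb : Bornology.IsBounded Ω)
    (f : ℝ → ℝ) (hf : Differentiable ℝ f)
    (ε L S : ℝ) (hε : 0 < ε) (hL : 0 < L) (hS : 0 ≤ S)
    (hfL : ∀ y, |deriv f y - S| ≤ L)
    (M N : ℕ) (hN : 1 ≤ N)
    (T : ℝ) (hT : 0 < T) (K : ℕ) (hK : 1 ≤ K) (τ : ℝ) (hτ : τ = T / K)
    (hτle : τ ≤ ε / (4 * L * √(6 * extrapConst (N - 1) ^ 2 + 1)))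
    (u : ℝ → H01 Ω) (hu : ContDiffOn ℝ (N + 1) u (Set.Icc 0 T))
    (hsol : ∀ n, 1 ≤ n → n ≤ K → IsWeakSolution f ε (node τ (n - 1)) (node τ n) u)
    (h : ℕ → ℝ → H01 Ω) (hfirst : h 1 ∈ discreteSpace Ω M N)
    (hscheme : ∀ n, 2 ≤ n → n ≤ K →
      IsSemiImplicitStep f ε S M N (node τ (n - 1)) (node τ n) (h (n - 1)) (h n))
    (n : ℕ) (hn : 2 ≤ n) (hnK : n ≤ K) :
    (1 + S / (2 * L)) * ‖toL2 (rho M N τ u h n (node τ n))‖ ^ 2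
      + ε ^ 2 / (2 * L) * ‖grad (rho M N τ u h n (node τ n))‖ ^ 2
      + ∑ k ∈ Finset.Icc 1 n,
          Dtau ε L τ N * slabNormSq τ k (fun t => toL2 (deriv (rho M N τ u h k) t))
      + D3 ε L τ N * τ * slabNormSq τ n (fun t => toL2 (deriv (rho M N τ u h n) t))
    ≤ ∑ k ∈ Finset.Icc 2 n,
          Real.exp (D2 ε L * (((n : ℝ) - k) * τ)) * Ehat ε L S M N T τ u k
      + Real.exp (D2 ε L * (((n : ℝ) - 1) * τ)) *
          ((1 + S / (2 * L)) * ‖toL2 (rho M N τ u h 1 (node τ 1))‖ ^ 2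
            + ε ^ 2 / (2 * L) * ‖grad (rho M N τ u h 1 (node τ 1))‖ ^ 2
            + D3 ε L τ N * τ * slabNormSq τ 1 (fun t => toL2 (deriv (rho M N τ u h 1) t)))
      + Dtau ε L τ N * slabNormSq τ 1 (fun t => toL2 (deriv (rho M N τ u h 1) t)) := by
  obtain ⟨m, rfl⟩ : ∃ m, N = m + 1 := ⟨N - 1, by omega⟩
  have hKpos : (0 : ℝ) < K := by exact_mod_cast hK
  have hτ0 : 0 < τ := by rw [hτ]; positivity
  have hu' := C1On.of_contDiffOn hT hu
  have hnode : ∀ k ≤ K, node τ k ≤ T := fun k hk => by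
    rw [node, hτ, mul_div_assoc', div_le_iff₀ hKpos, mul_comm]
    exact mul_le_mul_of_nonneg_left (by exact_mod_cast hk) hT.le
  have hmem : ∀ k, 1 ≤ k → k ≤ K → h k ∈ discreteSpace Ω M (m + 1) := fun k h1 hk => by
    rcases h1.eq_or_lt with rfl | h2
    · exact hfirst
    · exact (hscheme k h2 hk).1
  have hslab : ∀ k, 1 ≤ k → ∀ w : ℝ → L2 Ω, 0 ≤ slabNormSq τ k w := fun k hk w =>
    intervalIntegral.integral_nonneg (mul_le_mul_of_nonneg_right
      (by exact_mod_cast Nat.sub_le k 1) hτ0.le) fun _ _ => sq_nonneg _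
  have hD := Dtau_nonneg hε hL hτ0 (m + 1) hτle
  have hD2 : 0 ≤ D2 ε L * τ := by unfold D2; positivity
  have hD3 : 0 ≤ D3 ε L τ (m + 1) := by unfold D3; positivity
  set r : ℕ → ℝ := fun k => Dtau ε L τ (m + 1) *
    slabNormSq τ k (fun t => toL2 (deriv (rho M (m + 1) τ u h k) t)) with hr
  set B : ℕ → ℝ := fun k =>
    (1 + S / (2 * L)) * ‖toL2 (rho M (m + 1) τ u h k (node τ k))‖ ^ 2
      + ε ^ 2 / (2 * L) * ‖grad (rho M (m + 1) τ u h k (node τ k))‖ ^ 2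
      + D3 ε L τ (m + 1) * τ *
        slabNormSq τ k (fun t => toL2 (deriv (rho M (m + 1) τ u h k) t)) with hB
  have hr0 : ∀ k, 0 ≤ r k := fun k => mul_nonneg hD
    (intervalIntegral.integral_nonneg (mul_le_mul_of_nonneg_right
      (by exact_mod_cast Nat.sub_le k 1) hτ0.le) fun _ _ => sq_nonneg _)
  have hrec : ∀ k, 1 ≤ k → k < n → B (k + 1) + r (k + 1) ≤
      Real.exp (D2 ε L * τ) * B k + Ehat ε L S M (m + 1) T τ u (k + 1) := by
    intro k hk1 hkn
    obtain ⟨j, rfl⟩ : ∃ j, k = j + 1 := ⟨k - 1, by omega⟩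
    have hstep := error_step hd hΩo hΩb hf hε hL hS hfL hτ0 hu' (hnode (j + 2) (by omega))
      (hsol (j + 2) (by omega) (by omega)) (hmem (j + 1) (by omega) (by omega))
      (hscheme (j + 2) (by omega) (by omega))
    have hB0 : 0 ≤ B (j + 1) := by
      have := hslab (j + 1) hk1 (fun t => toL2 (deriv (rho M (m + 1) τ u h (j + 1)) t))
      positivity
    -- Replacing `1 + D_2 τ` by its exponential needs the sign of `B`.
    have hexp := mul_le_mul_of_nonneg_right (Real.add_one_le_exp (D2 ε L * τ)) hB0
    rw [add_comm (D2 ε L * τ)] at hexp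
    have hsum : B (j + 1 + 1) + r (j + 1 + 1) ≤
        (1 + D2 ε L * τ) * B (j + 1) + Ehat ε L S M (m + 1) T τ u (j + 1 + 1) := by
      refine le_trans (le_of_eq ?_) hstep
      simp only [hB, hr]
      ring
    linarith
  have hfinal := discrete_gronwall hD2 (by omega : 1 ≤ n) hr0 hrec
  refine le_trans (le_of_eq ?_) hfinal
  simp only [hB, hr]
  ring
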